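/- Call a planar diagram of an oriented link a link diagram, two link diagrams being equivalent if they are related by Reidemeister moves. The Alexander–Conway polynomial $\nabla_L(z)\in\mathbb{Z}[z]$ of an oriented link $L$ is the link invariant determined recursively by $\nabla(\text{unknot})=1$ and the skein relation $$\nabla(L_+)=\nabla(L_-)+z\,\nabla(L_0),$$ where $L_+$, $L_-$, $L_0$ have diagrams that differ only at one place, where they have, respectively, a positive crossing, a negative crossing, and the orientation-respecting smoothing (it follows that unlinks with two or more components have $\nabla=0$). For an integer $q$ let $T_{2,q}$ be the $(2,q)$-torus link: the closure of the 2-strand braid $\sigma_1^q$, i.e. two parallel strands with $|q|$ crossings, all positive if $q>0$ and all negative if $q<0$. **Lemma.** Let $q$ be an odd integer. Then the coefficient of $z^2$ in the Alexander–Conway polynomial of the $(2,q)$-torus knot, computed by the skein recursion from any diagram equivalent to the standard one, is $$\nabla_{T_{2,q}}(z)_2=\frac{(q-1)(q+1)}{8}.$$ -/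

import Mathlib

open Polynomial

/-- The two sides of an oriented edge. -/
inductive Side where
  | L
  | R

/-- A combinatorial oriented link diagram. Finitely many marked points `X` lie on the strands and
`next` sends a point to the following one along the orientation; the edge from `x` to `next x` is
denoted by its tail `x`. At a crossing `c`, drawn with both strands running upwards,
the strand from bottom left to top right passes through the point `left c`, and the strand
from bottom right to top left passes through the point `right c`. The crossing is positive iff
the strand through `left c` is the over-strand. The points which belong to no crossing are merely
marks on a strand; crossingless circles are cycles of such marks. -/
structure LinkDiagram where
  X : Type
  C : Type
  finite_X : Finite X
  next : Equiv.Perm X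
  left : C → X
  right : C → X
  injective_points : Function.Injective (Sum.elim left right)
  positive : C → Bool

namespace LinkDiagram

/-- The point through which the over-strand of `c` passes. -/
def overPt (D : LinkDiagram) (c : D.C) : D.X :=
  if D.positive c then D.left c else D.right c

/-- The point through which the under-strand of `c` passes. -/
def underPt (D : LinkDiagram) (c : D.C) : D.X :=
  if D.positive c then D.right c else D.left c

/-! ### Faces and planarity -/

/-- The four corners at a crossing (bottom, right, top and left, in this order): each of them joins
a side of one edge at `c` with a side of another edge at `c`. -/
inductive CornerAux (D : LinkDiagram) (c : D.C) : D.X × Side → D.X × Side → Prop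
  | bottom : CornerAux D c (D.next.symm (D.left c), Side.R) (D.next.symm (D.right c), Side.L)
  | east : CornerAux D c (D.next.symm (D.right c), Side.R) (D.left c, Side.R)
  | top : CornerAux D c (D.left c, Side.L) (D.right c, Side.R)
  | west : CornerAux D c (D.right c, Side.L) (D.next.symm (D.left c), Side.L)

/-- The edge sides `s` and `t` meet in a corner at the crossing `c`. -/
def Corner (D : LinkDiagram) (c : D.C) (s t : D.X × Side) : Prop :=
  D.CornerAux c s t ∨ D.CornerAux c t s

/-- A point that belongs to no crossing. -/
def IsMark (D : LinkDiagram) (x : D.X) : Prop := ∀ c, D.left c ≠ x ∧ D.right c ≠ x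

/-- Two edge sides are consecutive on the boundary of a face: they meet in a corner at a crossing,
or they are the same side of the two edges at a mark. -/
def FaceAdj (D : LinkDiagram) (s t : D.X × Side) : Prop :=
  (∃ c, D.Corner c s t) ∨
    ∃ x, D.IsMark x ∧ s.1 = D.next.symm x ∧ t.1 = x ∧ s.2 = t.2

/-- The faces: classes of edge sides under the equivalence relation generated by `FaceAdj`. -/
def Face (D : LinkDiagram) : Type := Quot D.FaceAdj

/-- Two points are joined by an edge or belong to the same crossing. -/
def PieceAdj (D : LinkDiagram) (x y : D.X) : Prop :=
  y = D.next x ∨ ∃ c, x = D.left c ∧ y = D.right c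

/-- The connected pieces of the underlying graph of the diagram. -/
def Piece (D : LinkDiagram) : Type := Quot D.PieceAdj

/-- Each piece is drawn on a sphere. By Euler's formula `V - E + F = 2 K`, where `K` is the number
of pieces, `E = #X` and `V = #X - #C`. -/
def Planar (D : LinkDiagram) : Prop :=
  Nat.card D.Face = Nat.card D.C + 2 * Nat.card D.Piece

/-! ### Operations on diagrams -/

/-- Erase the crossings in `S`, by pulling their two strands apart without changing how the
strands run. -/
def erase (D : LinkDiagram) (S : Set D.C) : LinkDiagram where
  X := D.X
  C := {c : D.C // c ∉ S}
  finite_X := D.finite_X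
  next := D.next
  left c := D.left c
  right c := D.right c
  injective_points := by
    have h := D.injective_points
    rintro (⟨a, ha⟩ | ⟨a, ha⟩) (⟨b, hb⟩ | ⟨b, hb⟩) hab
    · have := @h (Sum.inl a) (Sum.inl b) hab; simpa using this
    · have := @h (Sum.inl a) (Sum.inr b) hab; simp at this
    · have := @h (Sum.inr a) (Sum.inl b) hab; simp at this
    · have := @h (Sum.inr a) (Sum.inr b) hab; simpa using this
  positive c := D.positive c

/-- Reroute the strands. -/
def reroute (D : LinkDiagram) (f : Equiv.Perm D.X) : LinkDiagram := { D with next := f }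

/-- Apply a permutation of the points to the positions of the crossings on the strands. -/
def relocate (D : LinkDiagram) (f : Equiv.Perm D.X) : LinkDiagram where
  X := D.X
  C := D.C
  finite_X := D.finite_X
  next := D.next
  left c := f (D.left c)
  right c := f (D.right c)
  injective_points := by
    have h := f.injective.comp D.injective_points
    rwa [Sum.comp_elim] at h
  positive := D.positive

open Classical in
/-- The same diagram, where the crossing `c` is positive if `b` is true and else negative. -/
noncomputable def withSign (D : LinkDiagram) (c : D.C) (b : Bool) : LinkDiagram :=
  { D with positive := Function.update D.positive c b }

open Classical in
/-- The oriented smoothing of `c`: the strand which arrives in `left c` leaves as the strand through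
`right c` did, and conversely. -/
noncomputable def smooth (D : LinkDiagram) (c : D.C) : LinkDiagram :=
  (D.reroute (D.next * Equiv.swap (D.left c) (D.right c))).erase {c}

open Classical in
/-- Put one more mark on the edge from `x` to `next x`. -/
noncomputable def addMark (D : LinkDiagram) (x : D.X) : LinkDiagram where
  X := Option D.X
  C := D.C
  finite_X := by have := D.finite_X; infer_instance
  next := Equiv.optionCongr D.next * Equiv.swap none (some x)
  left c := some (D.left c)
  right c := some (D.right c)
  injective_points := by
    have h := (Option.some_injective D.X).comp D.injective_points
    rwa [Sum.comp_elim] at h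
  positive := D.positive

/-- An isomorphism of diagrams. -/
structure Iso (D E : LinkDiagram) where
  onX : D.X ≃ E.X
  onC : D.C ≃ E.C
  next_comm : ∀ x, onX (D.next x) = E.next (onX x)
  left_comm : ∀ c, onX (D.left c) = E.left (onC c)
  right_comm : ∀ c, onX (D.right c) = E.right (onC c)
  positive_comm : ∀ c, D.positive c = E.positive (onC c)

/-! ### Reidemeister moves -/

/-- The edge with tail `x` is over at both of its ends. -/
def EdgeOver (D : LinkDiagram) (x : D.X) : Prop :=
  (∃ c, D.overPt c = x) ∧ ∃ c, D.overPt c = D.next x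

/-- The edge with tail `x` is under at both of its ends. -/
def EdgeUnder (D : LinkDiagram) (x : D.X) : Prop :=
  (∃ c, D.underPt c = x) ∧ ∃ c, D.underPt c = D.next x

open Classical in
/-- Exchange the two ends of each of three edges. -/
noncomputable def swapEnds (D : LinkDiagram) (x y z : D.X) : Equiv.Perm D.X :=
  Equiv.swap x (D.next x) * Equiv.swap y (D.next y) * Equiv.swap z (D.next z)

/-- The elementary moves: isomorphism, insertion of a mark, and the three Reidemeister moves.
* `r1` removes a crossing with a face that has one side;
* `r2` removes two crossings at a face with two sides `s` and `t`,
  where the edge of `s` runs over and the edge of `t` under at both crossings;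
* `r3` acts at a face with three sides `s`, `t`, `u` and three different crossings,
  where the edge of `s` runs over and the edge of `u` under at both of its ends: on each of the
  three strands the order of the two crossings is reversed. -/
inductive Move : LinkDiagram → LinkDiagram → Prop
  | iso {D E : LinkDiagram} (e : Iso D E) : Move D E
  | mark (D : LinkDiagram) (x : D.X) : Move D (D.addMark x)
  | r1 (D : LinkDiagram) (c : D.C) (s : D.X × Side) (h : D.Corner c s s) : Move D (D.erase {c})
  | r2 (D : LinkDiagram) (a b : D.C) (s t : D.X × Side) (hab : a ≠ b)
      (ha : D.Corner a s t) (hb : D.Corner b s t)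
      (hs : D.EdgeOver s.1) (ht : D.EdgeUnder t.1) : Move D (D.erase {a, b})
  | r3 (D : LinkDiagram) (a b c : D.C) (s t u : D.X × Side)
      (hab : a ≠ b) (hac : a ≠ c) (hbc : b ≠ c)
      (ha : D.Corner a s t) (hb : D.Corner b s u) (hc : D.Corner c t u)
      (hs : D.EdgeOver s.1) (hu : D.EdgeUnder u.1) :
      Move D (D.relocate (D.swapEnds s.1 t.1 u.1))

/-- Two diagrams present the same oriented link: they are joined by a finite sequence of elementary
moves and their inverses between planar diagrams. -/
def Equivalent : LinkDiagram → LinkDiagram → Prop :=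
  Relation.EqvGen fun D E => D.Planar ∧ E.Planar ∧ Move D E

/-! ### The Conway polynomial -/

/-- `n` disjoint circles without crossings. -/
def circles (n : ℕ) : LinkDiagram where
  X := Fin n
  C := Empty
  finite_X := inferInstance
  next := 1
  left := Empty.elim
  right := Empty.elim
  injective_points := by rintro (a | a) <;> exact a.elim
  positive := Empty.elim

/-- `HasConway D p`: the polynomial `p` in the variable `z = X` is obtained as the
Alexander-Conway polynomial of the link diagram `D` by the skein recursion. The
rules are: the unknot has `∇ = 1`; `∇` is a link invariant; and `∇ (L₊) = ∇ (L₋) + z ∇ (L₀)` at each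
crossing of a planar diagram. The recursion may also end in two or more disjoint circles,
where `∇ = 0`; this value is forced by the other rules, as the two ways of joining two of the
circles at a crossing give the same link, and their smoothing is the given one. -/
inductive HasConway : LinkDiagram → ℤ[X] → Prop
  | unknot : HasConway (circles 1) 1
  | unlink (n : ℕ) (hn : 2 ≤ n) : HasConway (circles n) 0
  | invariant {D E : LinkDiagram} {p : ℤ[X]} (h : Equivalent D E) (hD : HasConway D p) :
      HasConway E p
  | skein_pos (D : LinkDiagram) (c : D.C) {p₁ p₀ : ℤ[X]} (hD : D.Planar)
      (h₁ : HasConway (D.withSign c false) p₁) (h₀ : HasConway (D.smooth c) p₀) :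
      HasConway (D.withSign c true) (p₁ + Polynomial.X * p₀)
  | skein_neg (D : LinkDiagram) (c : D.C) {p₁ p₀ : ℤ[X]} (hD : D.Planar)
      (h₁ : HasConway (D.withSign c true) p₁) (h₀ : HasConway (D.smooth c) p₀) :
      HasConway (D.withSign c false) (p₁ - Polynomial.X * p₀)

/-! ### Torus links -/

/-- The standard diagram of the `(2, q)`-torus link: two parallel strands that run around
the axis of the torus and cross each other `|q|` times on the way, the crossings being
positive for `q > 0` and negative for `q < 0` (the closure of the 2-braid `σ₁ ^ q`).
The strand which enters the `j`-th crossing on one side enters the next one on the other side. -/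
def torusTwo (q : ℤ) : LinkDiagram where
  X := Fin q.natAbs × Bool
  C := Fin q.natAbs
  finite_X := inferInstance
  next := Equiv.prodCongr (finRotate q.natAbs) Equiv.boolNot
  left j := (j, true)
  right j := (j, false)
  injective_points := by rintro (a | a) (b | b) h <;> simp_all
  positive _ := decide (0 < q)

end LinkDiagram

/-! `HasConway` is a relation between diagrams and polynomials; that it is a function is not
assumed. The proof avoids the well-definedness of the whole polynomial by identifying its low
coefficients with quantities read off the diagram: the constant term tells whether the link is a
knot, the coefficient of z of a two-component link is the linking number, and the coefficient of z²
of a knot is the Gauss diagram sum of Polyak and Viro (`casson`). `HasConway.lowCoeffs` proves this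
by induction on a derivation. For that, the quantities have to survive the elementary moves
(`Move.sameInvariants`) and satisfy the skein relation in degrees at most two (`LowCoeffs.skein`):
changing a self-crossing of a knot changes `casson` by the linking number of the smoothing.

The Gauss sum depends on a base point, and its independence of it (`Planar.casson_eq`) is where
planarity matters. Two arcs of a knot that share the ends at one crossing form two loops, and on a
sphere two loops have intersection number zero (`Planar.half_crossings`). The homological input is
that every circulation on the edges is the jump of a function on the faces
(`Planar.exists_jump_eq`); it follows from Euler's formula by counting dimensions over ℚ.

For existence, the torus link is written as the closure of a two-strand braid. Levels without a
crossing are kept as pairs of marks, so that changing or smoothing the last crossing stays in the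
family `braid M n b`. The skein relation at the last crossing gives the recursion `torusConway`, and
the z² coefficient for q = ±(2k+1) is k(k+1)/2 = (q²-1)/8. Uniqueness of the z² coefficient then
transfers this value to every derivation for every equivalent diagram. -/

namespace LinkDiagram

/-! ### Finiteness -/

noncomputable instance (D : LinkDiagram) : Fintype D.X := @Fintype.ofFinite _ D.finite_X

instance (D : LinkDiagram) : Finite D.C :=
  Finite.of_injective (fun c => D.left c)
    fun _ _ h => Sum.inl_injective (D.injective_points h)

noncomputable instance (D : LinkDiagram) : Fintype D.C := Fintype.ofFinite _

instance : Finite Side :=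
  Finite.of_injective (fun s : Side => match s with | .L => true | .R => false) (by
    rintro (_ | _) (_ | _) h <;> simp_all)

instance (D : LinkDiagram) : Finite D.Face := by unfold Face; infer_instance

instance (D : LinkDiagram) : Finite D.Piece := by unfold Piece; infer_instance

noncomputable instance (D : LinkDiagram) : Fintype D.Face := Fintype.ofFinite _

noncomputable instance (D : LinkDiagram) : Fintype D.Piece := Fintype.ofFinite _

variable (D : LinkDiagram)

theorem left_injective : Function.Injective D.left :=
  fun _ _ h => Sum.inl_injective (D.injective_points h)

theorem right_injective : Function.Injective D.right :=
  fun _ _ h => Sum.inr_injective (D.injective_points h)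

theorem left_ne_right (c d : D.C) : D.left c ≠ D.right d := fun h => by
  have := @D.injective_points (Sum.inl c) (Sum.inr d) h
  simp at this

/-- A point is a mark or lies on one of the two strands of a crossing. -/
theorem isMark_or (x : D.X) : D.IsMark x ∨ ∃ c, D.left c = x ∨ D.right c = x := by
  by_cases h : ∃ c, D.left c = x ∨ D.right c = x
  · exact Or.inr h
  · push Not at h
    exact Or.inl h

/-- A sum over all points of a function that vanishes at the marks. -/
theorem sum_points {M : Type*} [AddCommMonoid M] (f : D.X → M) (hf : ∀ x, D.IsMark x → f x = 0) :
    ∑ x, f x = ∑ c, (f (D.left c) + f (D.right c)) := by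
  rw [Finset.sum_add_distrib]
  refine Eq.trans ?_ (Fintype.sum_sum_type
    (Sum.elim (fun c => f (D.left c)) (fun c => f (D.right c))))
  symm
  apply Fintype.sum_of_injective (Sum.elim D.left D.right) D.injective_points
  · intro x hx
    apply hf
    intro c
    constructor
    · intro h; exact hx ⟨Sum.inl c, h⟩
    · intro h; exact hx ⟨Sum.inr c, h⟩
  · rintro (c | c) <;> rfl

/-! ### Potentials of circulations on planar diagrams -/

/-- A function on the edges which satisfies Kirchhoff's law at every mark and every crossing. -/
structure IsCirculation (g : D.X → ℚ) : Prop where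
  mark : ∀ x, D.IsMark x → g (D.next.symm x) = g x
  crossing : ∀ c, g (D.next.symm (D.left c)) + g (D.next.symm (D.right c)) =
    g (D.left c) + g (D.right c)

/-- The circulations form a subspace. -/
def circulations : Submodule ℚ (D.X → ℚ) where
  carrier := {g | D.IsCirculation g}
  add_mem' {a b} ha hb := by
    refine ⟨fun x hx => ?_, fun c => ?_⟩
    · simp [ha.mark x hx, hb.mark x hx]
    · have h1 := ha.crossing c
      have h2 := hb.crossing c
      simp only [Pi.add_apply]
      linarith
  zero_mem' := ⟨fun _ _ => rfl, fun _ => rfl⟩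
  smul_mem' r a ha := by
    refine ⟨fun x hx => ?_, fun c => ?_⟩
    · simp [ha.mark x hx]
    · have h1 := ha.crossing c
      simp only [Pi.smul_apply, smul_eq_mul, ← mul_add, h1]

/-- The face on a given side of an edge. -/
def faceOf (s : D.X × Side) : D.Face := Quot.mk _ s

/-- The piece of a point. -/
def pieceOf (x : D.X) : D.Piece := Quot.mk _ x

theorem faceOf_eq {s t : D.X × Side} (h : D.FaceAdj s t) : D.faceOf s = D.faceOf t := Quot.sound h

theorem faceOf_bottom (c : D.C) :
    D.faceOf (D.next.symm (D.left c), Side.R) = D.faceOf (D.next.symm (D.right c), Side.L) :=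
  D.faceOf_eq (Or.inl ⟨c, Or.inl .bottom⟩)

theorem faceOf_east (c : D.C) :
    D.faceOf (D.next.symm (D.right c), Side.R) = D.faceOf (D.left c, Side.R) :=
  D.faceOf_eq (Or.inl ⟨c, Or.inl .east⟩)

theorem faceOf_top (c : D.C) : D.faceOf (D.left c, Side.L) = D.faceOf (D.right c, Side.R) :=
  D.faceOf_eq (Or.inl ⟨c, Or.inl .top⟩)

theorem faceOf_west (c : D.C) :
    D.faceOf (D.right c, Side.L) = D.faceOf (D.next.symm (D.left c), Side.L) :=
  D.faceOf_eq (Or.inl ⟨c, Or.inl .west⟩)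

theorem faceOf_mark {x : D.X} (hx : D.IsMark x) (s : Side) :
    D.faceOf (D.next.symm x, s) = D.faceOf (x, s) :=
  D.faceOf_eq (Or.inr ⟨x, hx, rfl, rfl, rfl⟩)

theorem pieceOf_next (x : D.X) : D.pieceOf (D.next x) = D.pieceOf x :=
  (Quot.sound (r := D.PieceAdj) (Or.inl rfl)).symm

theorem pieceOf_symm (x : D.X) : D.pieceOf (D.next.symm x) = D.pieceOf x := by
  simpa using (D.pieceOf_next (D.next.symm x)).symm

theorem pieceOf_left (c : D.C) : D.pieceOf (D.left c) = D.pieceOf (D.right c) :=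
  Quot.sound (Or.inr ⟨c, rfl, rfl⟩)

/-- The piece to which a face belongs. -/
def facePiece : D.Face → D.Piece :=
  Quot.lift (fun s => D.pieceOf s.1) (by
    have key : ∀ c s t, D.CornerAux c s t → D.pieceOf s.1 = D.pieceOf t.1 := by
      rintro c s t (_ | _ | _ | _) <;> simp [pieceOf_symm, pieceOf_left]
    rintro s t (⟨c, h | h⟩ | ⟨x, -, h1, h2, -⟩)
    · exact key c s t h
    · exact (key c t s h).symm
    · rw [h1, h2, pieceOf_symm])

/-- The jump of a function on the faces across the edges. -/
def jump : (D.Face → ℚ) →ₗ[ℚ] (D.X → ℚ) where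
  toFun f x := f (D.faceOf (x, Side.L)) - f (D.faceOf (x, Side.R))
  map_add' f g := by ext x; simp; ring
  map_smul' r f := by ext x; simp; ring

/-- At a crossing the incoming jumps and the outgoing jumps both telescope to the value on the west
face minus the value on the east face. -/
theorem jump_mem (f : D.Face → ℚ) : D.jump f ∈ D.circulations := by
  refine ⟨fun x hx => ?_, fun c => ?_⟩
  · simp [jump, faceOf_mark D hx]
  · simp only [jump, LinearMap.coe_mk, AddHom.coe_mk, faceOf_bottom, faceOf_east, faceOf_top,
      ← faceOf_west]
    ring

/-- A face function without jumps has one value per edge, and the corners carry this value across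
every crossing and along every strand. Hence it factors through `facePiece`. -/
theorem finrank_ker_jump : Module.finrank ℚ (LinearMap.ker D.jump) ≤ Nat.card D.Piece := by
  have hle : LinearMap.ker D.jump ≤ LinearMap.range (LinearMap.funLeft ℚ ℚ D.facePiece) := by
    intro f hf
    have hf' : ∀ x, f (D.faceOf (x, Side.L)) = f (D.faceOf (x, Side.R)) := fun x =>
      sub_eq_zero.1 (congrFun hf x)
    have h1 : ∀ c, f (D.faceOf (D.left c, Side.L)) = f (D.faceOf (D.right c, Side.L)) := fun c => by
      rw [faceOf_top, hf']
    have h2 : ∀ x, f (D.faceOf (D.next.symm x, Side.L)) = f (D.faceOf (x, Side.L)) := by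
      intro x
      rcases D.isMark_or x with hx | ⟨c, rfl | rfl⟩
      · rw [faceOf_mark D hx]
      · rw [← faceOf_west, h1]
      · rw [← faceOf_bottom, ← hf', ← faceOf_west]
    refine ⟨Quot.lift (fun x => f (D.faceOf (x, Side.L))) ?_, ?_⟩
    · rintro x y (rfl | ⟨c, rfl, rfl⟩)
      · simpa using h2 (D.next x)
      · exact h1 c
    · ext ⟨x, s⟩
      cases s
      · rfl
      · exact hf' x
  calc _ ≤ Module.finrank ℚ (LinearMap.range (LinearMap.funLeft ℚ ℚ D.facePiece)) :=
        Submodule.finrank_mono hle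
    _ ≤ Module.finrank ℚ (D.Piece → ℚ) := LinearMap.finrank_range_le _
    _ = _ := by simp

/-- Functions on the points with the same value at both points of a crossing. -/
def vertexDiff : (D.X → ℚ) →ₗ[ℚ] (D.C → ℚ) where
  toFun h c := h (D.left c) - h (D.right c)
  map_add' f g := by ext x; simp; ring
  map_smul' r f := by ext x; simp; ring

/-- The coboundary of a function on the points. -/
def coboundary : (D.X → ℚ) →ₗ[ℚ] (D.X → ℚ) where
  toFun h x := h (D.next x) - h x
  map_add' f g := by ext x; simp; ring
  map_smul' r f := by ext x; simp; ring

/-- The kernel of `vertexDiff` consists of the functions on the vertices of the underlying graph.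
Those with zero coboundary are constant on each piece. -/
theorem finrank_ker_coboundary :
    Module.finrank ℚ (LinearMap.ker (D.coboundary.domRestrict (LinearMap.ker D.vertexDiff))) ≤
      Nat.card D.Piece := by
  have hle : (LinearMap.ker (D.coboundary.domRestrict (LinearMap.ker D.vertexDiff))).map
      (LinearMap.ker D.vertexDiff).subtype ≤ LinearMap.range (LinearMap.funLeft ℚ ℚ D.pieceOf) := by
    rintro _ ⟨⟨h, hv⟩, hh, rfl⟩
    have h1 : ∀ x, h (D.next x) = h x := fun x => sub_eq_zero.1 (congrFun hh x)
    have h2 : ∀ c, h (D.left c) = h (D.right c) := fun c => sub_eq_zero.1 (congrFun hv c)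
    refine ⟨Quot.lift h ?_, rfl⟩
    rintro x y (rfl | ⟨c, rfl, rfl⟩)
    · exact (h1 x).symm
    · exact h2 c
  calc _ = _ := LinearEquiv.finrank_eq (Submodule.equivSubtypeMap _ _)
    _ ≤ Module.finrank ℚ (LinearMap.range (LinearMap.funLeft ℚ ℚ D.pieceOf)) :=
        Submodule.finrank_mono hle
    _ ≤ Module.finrank ℚ (D.Piece → ℚ) := LinearMap.finrank_range_le _
    _ = _ := by simp

/-- Summation by parts: cycles are orthogonal to coboundaries. -/
theorem circulation_orthogonal {g h : D.X → ℚ} (hg : D.IsCirculation g)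
    (hh : ∀ c, h (D.left c) = h (D.right c)) : ∑ x, g x * D.coboundary h x = 0 := by
  have h1 : ∑ x, g x * D.coboundary h x = ∑ x, h x * (g (D.next.symm x) - g x) := by
    simp only [coboundary, LinearMap.coe_mk, AddHom.coe_mk, mul_sub, Finset.sum_sub_distrib]
    congr 1
    · rw [← Equiv.sum_comp D.next (fun x => h x * g (D.next.symm x))]
      simp [mul_comm]
    · simp [mul_comm]
  rw [h1, sum_points]
  · apply Finset.sum_eq_zero
    intro c _
    rw [hh c, ← mul_add]
    have := hg.crossing c
    rw [show g (D.next.symm (D.left c)) - g (D.left c) +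
      (g (D.next.symm (D.right c)) - g (D.right c)) = 0 by linarith, mul_zero]
  · intro x hx
    rw [hg.mark x hx, sub_self, mul_zero]

/-- The coboundaries of vertex functions have dimension at least (#X - #C) - #pieces and meet the
circulations only in zero, so the circulations have dimension at most #C + #pieces. -/
theorem finrank_circulations :
    Module.finrank ℚ D.circulations ≤ Nat.card D.C + Nat.card D.Piece := by
  let T := D.coboundary.domRestrict (LinearMap.ker D.vertexDiff)
  have hdisj : Disjoint D.circulations (LinearMap.range T) := by
    rw [Submodule.disjoint_def]
    rintro g hg ⟨⟨h, hv⟩, rfl⟩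
    have h2 : ∀ c, h (D.left c) = h (D.right c) := fun c => sub_eq_zero.1 (congrFun hv c)
    have h0 := D.circulation_orthogonal hg h2
    -- A circulation that is also a coboundary is orthogonal to itself, and the standard form over ℚ
    -- is definite.
    have h0' : ∑ x, (T ⟨h, hv⟩ x) * (T ⟨h, hv⟩ x) = 0 := h0
    rw [Finset.sum_eq_zero_iff_of_nonneg (fun x _ => mul_self_nonneg _)] at h0'
    ext x
    exact mul_self_eq_zero.1 (h0' x (Finset.mem_univ x))
  have h1 := Submodule.finrank_add_finrank_le_of_disjoint hdisj
  have h2 := LinearMap.finrank_range_add_finrank_ker T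
  have h3 : Module.finrank ℚ (LinearMap.ker T) ≤ _ := D.finrank_ker_coboundary
  have h4 := LinearMap.finrank_range_add_finrank_ker D.vertexDiff
  have h5 : Module.finrank ℚ (LinearMap.range D.vertexDiff) ≤ Module.finrank ℚ (D.C → ℚ) :=
    Submodule.finrank_le _
  simp only [Module.finrank_fintype_fun_eq_card, ← Nat.card_eq_fintype_card] at *
  omega

/-- On a planar diagram every circulation is the jump of a function on the faces. -/
theorem Planar.exists_jump_eq {D : LinkDiagram} (hD : D.Planar) {g : D.X → ℚ}
    (hg : D.IsCirculation g) : ∃ f, D.jump f = g := by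
  have hle : LinearMap.range D.jump ≤ D.circulations := by
    rintro _ ⟨f, rfl⟩
    exact D.jump_mem f
  have h1 := LinearMap.finrank_range_add_finrank_ker D.jump
  have h2 := D.finrank_ker_jump
  have h3 := D.finrank_circulations
  have h4 : Nat.card D.Face = Nat.card D.C + 2 * Nat.card D.Piece := hD
  simp only [Module.finrank_fintype_fun_eq_card, ← Nat.card_eq_fintype_card] at h1
  -- By Euler's formula the image of `jump` has dimension at least #faces - #pieces = #C + #pieces,
  -- which is the upper bound for the circulations.
  have := Submodule.eq_of_le_of_finrank_le hle (by omega)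
  have hmem : g ∈ LinearMap.range D.jump := this ▸ hg
  exact hmem

end LinkDiagram

/-! ### Positions along a cycle -/

namespace Equiv.Perm

/-- The number of steps from `b` to `x` along a permutation. -/
noncomputable def stepsFrom {X : Type*} (f : Perm X) (b x : X) : ℕ := sInf {k | (f ^ k) b = x}

variable {X : Type*} {f : Perm X} {b : X}

theorem stepsFrom_le {x : X} {k : ℕ} (h : (f ^ k) b = x) : f.stepsFrom b x ≤ k := Nat.sInf_le h

@[simp] theorem stepsFrom_self : f.stepsFrom b b = 0 := Nat.le_zero.1 (stepsFrom_le rfl)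

theorem pow_succ_apply' (k : ℕ) (x : X) : (f ^ (k + 1)) x = f ((f ^ k) x) := by
  rw [pow_succ', mul_apply]

variable [Finite X] (hb : ∀ x, f.SameCycle b x)

include hb

/-- The assumption that all points lie on the cycle of `b` makes the set in `stepsFrom` nonempty;
for an unreachable point `sInf` would return 0. -/
theorem pow_stepsFrom (x : X) : (f ^ f.stepsFrom b x) b = x := by
  obtain ⟨k, -, hk⟩ := (hb x).exists_pow_eq'
  exact Nat.sInf_mem (s := {k | (f ^ k) b = x}) ⟨k, hk⟩

theorem stepsFrom_injective : Function.Injective (f.stepsFrom b) := fun x y h => by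
  rw [← pow_stepsFrom hb x, ← pow_stepsFrom hb y, h]

theorem stepsFrom_pos {x : X} (hx : x ≠ b) : 0 < f.stepsFrom b x := by
  rw [Nat.pos_iff_ne_zero]
  intro h
  have := pow_stepsFrom hb x
  rw [h] at this
  exact hx this.symm

theorem stepsFrom_apply {x : X} (hx : f x ≠ b) : f.stepsFrom b (f x) = f.stepsFrom b x + 1 := by
  apply le_antisymm
  · apply stepsFrom_le
    rw [pow_succ_apply', pow_stepsFrom hb]
  · obtain ⟨q, hq⟩ := Nat.exists_eq_succ_of_ne_zero (stepsFrom_pos hb hx).ne'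
    have h := pow_stepsFrom hb (f x)
    rw [hq, Nat.succ_eq_add_one, pow_succ_apply'] at h
    have := stepsFrom_le (f.injective h)
    omega

theorem stepsFrom_symm {x : X} (hx : x ≠ b) :
    f.stepsFrom b (f.symm x) + 1 = f.stepsFrom b x := by
  have := stepsFrom_apply hb (x := f.symm x) (by simpa using hx)
  simpa using this.symm

/-- If a point took `m` steps or more, a round trip of length `m` could be cut out of the way to it.
-/
theorem stepsFrom_lt_of_pow_eq {m : ℕ} (hm : 0 < m) (h : (f ^ m) b = b) (x : X) :
    f.stepsFrom b x < m := by
  by_contra hlt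
  have h1 := pow_stepsFrom hb x
  have h2 : (f ^ (f.stepsFrom b x - m)) b = x := by
    rw [← h1]
    conv_rhs => rw [show f.stepsFrom b x = (f.stepsFrom b x - m) + m by omega, pow_add, mul_apply,
      h]
    rw [h1]
  have := stepsFrom_le h2
  omega

theorem stepsFrom_le_symm (x : X) : f.stepsFrom b x ≤ f.stepsFrom b (f.symm b) := by
  have := stepsFrom_lt_of_pow_eq hb (m := f.stepsFrom b (f.symm b) + 1) (Nat.succ_pos _)
    (by rw [pow_succ_apply', pow_stepsFrom hb]; simp) x
  omega

/-- Moving the base point one step on lowers every position by one, except that the old base point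
goes from the first place to the last (`stepsFrom_apply_base_lt`). -/
theorem stepsFrom_apply_base {x : X} (hx : x ≠ b) :
    f.stepsFrom (f b) x + 1 = f.stepsFrom b x := by
  have hb' : ∀ y, f.SameCycle (f b) y := fun y => sameCycle_apply_left.2 (hb y)
  apply le_antisymm
  · obtain ⟨q, hq⟩ := Nat.exists_eq_succ_of_ne_zero (stepsFrom_pos hb hx).ne'
    have h := pow_stepsFrom hb x
    rw [hq, Nat.succ_eq_add_one, pow_succ, mul_apply] at h
    have := stepsFrom_le h
    omega
  · apply stepsFrom_le
    rw [pow_succ, mul_apply, pow_stepsFrom hb']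

theorem stepsFrom_apply_base_lt {x : X} (hx : x ≠ b) :
    f.stepsFrom (f b) x < f.stepsFrom (f b) b := by
  have hb' : ∀ y, f.SameCycle (f b) y := fun y => sameCycle_apply_left.2 (hb y)
  refine lt_of_le_of_ne ?_ fun h => hx (stepsFrom_injective hb' h)
  simpa using stepsFrom_le_symm hb' x

end Equiv.Perm

/-! ### The two halves of a planar knot diagram at a crossing -/

namespace LinkDiagram

variable (D : LinkDiagram)

/-- The sign of a crossing. -/
def sign (c : D.C) : ℤ := if D.positive c then 1 else -1

/-- The diagram has one component. -/
def IsKnot : Prop := ∃ x, ∀ y, D.next.SameCycle x y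

variable {D}

theorem IsKnot.sameCycle (h : D.IsKnot) (x y : D.X) : D.next.SameCycle x y := by
  obtain ⟨z, hz⟩ := h
  exact (hz x).symm.trans (hz y)

open Equiv.Perm in
/-- Along one of the two halves into which a crossing divides a planar knot diagram, the other half
crosses as often from left to right as from right to left. -/
theorem Planar.half_crossings (hD : D.Planar) (hK : D.IsKnot) {c : D.C} {x y : D.X}
    (hxy : (x = D.left c ∧ y = D.right c) ∨ (x = D.right c ∧ y = D.left c)) :
    ∑ d, (if D.next.stepsFrom x (D.left d) < D.next.stepsFrom x y ∧
        D.next.stepsFrom x y < D.next.stepsFrom x (D.right d) then (1 : ℚ) else 0) =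
      ∑ d, (if D.next.stepsFrom x (D.right d) < D.next.stepsFrom x y ∧
        D.next.stepsFrom x y < D.next.stepsFrom x (D.left d) then (1 : ℚ) else 0) := by
  classical
  have hb : ∀ z, D.next.SameCycle x z := hK.sameCycle x
  set P := D.next.stepsFrom x with hP
  have hinj : Function.Injective P := stepsFrom_injective hb
  have hne : x ≠ y := by
    rcases hxy with ⟨rfl, rfl⟩ | ⟨rfl, rfl⟩
    · exact D.left_ne_right _ _
    · exact (D.left_ne_right _ _).symm
  have hPx : P x = 0 := stepsFrom_self
  have hPy : 0 < P y := stepsFrom_pos hb hne.symm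
  have hsymm : ∀ z, z ≠ x → P (D.next.symm z) + 1 = P z := fun z hz => stepsFrom_symm hb hz
  have hmax : ∀ z, P z ≤ P (D.next.symm x) := stepsFrom_le_symm hb
  -- The indicator of the edges from `x` up to the arrival at `y`. As `x` and `y` belong to the same
  -- crossing, these edges form a closed loop, so `g` is a circulation.
  let g : D.X → ℚ := fun z => if P z < P y then 1 else 0
  have hgsymm : ∀ z, z ≠ x → z ≠ y → g (D.next.symm z) = g z := by
    intro z hz hzy
    have h1 := hsymm z hz
    have h2 : P z ≠ P y := fun h => hzy (hinj h)
    simp only [g]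
    congr 1
    simp only [eq_iff_iff]
    omega
  have hgx : g x = 1 := by simp [g, hPx, hPy]
  have hgy : g y = 0 := by simp [g]
  have hgpx : g (D.next.symm x) = 0 := by
    have := hmax y
    simp only [g]
    rw [if_neg (by omega)]
  have hgpy : g (D.next.symm y) = 1 := by
    have := hsymm y hne.symm
    simp only [g]
    rw [if_pos (by omega)]
  have hmk : ∀ z, D.IsMark z → z ≠ x ∧ z ≠ y := by
    intro z hz
    rcases hxy with ⟨rfl, rfl⟩ | ⟨rfl, rfl⟩
    · exact ⟨(hz c).1.symm, (hz c).2.symm⟩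
    · exact ⟨(hz c).2.symm, (hz c).1.symm⟩
  have hdc : ∀ d, d ≠ c → (D.left d ≠ x ∧ D.left d ≠ y) ∧ (D.right d ≠ x ∧ D.right d ≠ y) := by
    intro d hd
    have h1 : D.left d ≠ D.left c := fun h => hd (D.left_injective h)
    have h2 : D.right d ≠ D.right c := fun h => hd (D.right_injective h)
    have h3 := D.left_ne_right d c
    have h4 := (D.left_ne_right c d).symm
    rcases hxy with ⟨rfl, rfl⟩ | ⟨rfl, rfl⟩
    · exact ⟨⟨h1, h3⟩, ⟨h4, h2⟩⟩
    · exact ⟨⟨h3, h1⟩, ⟨h2, h4⟩⟩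
  have hcirc : D.IsCirculation g := by
    refine ⟨fun z hz => hgsymm z (hmk z hz).1 (hmk z hz).2, fun d => ?_⟩
    by_cases hd : d = c
    · subst hd
      rcases hxy with ⟨rfl, rfl⟩ | ⟨rfl, rfl⟩ <;> simp [hgx, hgy, hgpx, hgpy]
    · obtain ⟨h1, h2⟩ := hdc d hd
      rw [hgsymm _ h1.1 h1.2, hgsymm _ h2.1 h2.2]
  obtain ⟨φ, hφ⟩ := hD.exists_jump_eq hcirc
  have hφ' : ∀ z, φ (D.faceOf (z, Side.L)) = φ (D.faceOf (z, Side.R)) + g z := by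
    intro z
    rw [← hφ]
    simp [jump]
  -- The potential on the left of a traveller along the strand. It is followed along the other half,
  -- whose points after its start `y` are selected by `h`.
  let F : D.X → ℚ := fun z => φ (D.faceOf (z, Side.L))
  let h : D.X → ℚ := fun z => if P y < P z then 1 else 0
  -- The other half is a loop as well: its first edge, leaving `y`, and its last edge, arriving at
  -- `x`, have the same potential on the left.
  have hF : F (D.next.symm x) = F y := by
    simp only [F]
    rcases hxy with ⟨rfl, rfl⟩ | ⟨rfl, rfl⟩
    · rw [faceOf_west]
    · rw [hφ', hφ', hgpx, hgy, faceOf_east]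
  -- The changes of the potential along the other half telescope to `F (D.next.symm x) - F y`, which
  -- is zero.
  have hsum : ∑ z, h z * (F z - F (D.next.symm z)) = 0 := by
    have h1 : ∑ z, h z * F (D.next.symm z) = ∑ z, h (D.next z) * F z := by
      rw [← Equiv.sum_comp D.next]
      simp
    simp only [mul_sub, Finset.sum_sub_distrib]
    rw [h1, ← Finset.sum_sub_distrib]
    have h2 : ∀ z, h z * F z - h (D.next z) * F z =
        (if z = D.next.symm x then F z else 0) - (if z = y then F z else 0) := by
      intro z
      rw [← sub_mul]
      by_cases hz : z = D.next.symm x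
      · subst hz
        have e1 : h (D.next (D.next.symm x)) = 0 := by simp [h, hPx]
        rw [e1]
        by_cases hy : D.next.symm x = y
        · simp [hy, h]
        · have : P y < P (D.next.symm x) := lt_of_le_of_ne (hmax y) fun e => hy (hinj e).symm
          simp [hy, h, this]
      · have hz' : D.next z ≠ x := fun e => hz (by simp [← e])
        have := hsymm _ hz'
        simp only [Equiv.symm_apply_apply] at this
        by_cases hy : z = y
        · subst hy
          simp [hz, h, ← this]
        · have h3 : P z ≠ P y := fun e => hy (hinj e)
          have h4 : h z = h (D.next z) := by
            simp only [h]
            congr 1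
            simp only [eq_iff_iff]
            omega
          simp [hz, hy, h4]
    rw [Finset.sum_congr rfl fun z _ => h2 z, Finset.sum_sub_distrib]
    simp [hF]
  rw [sum_points] at hsum
  · rw [← sub_eq_zero, ← Finset.sum_sub_distrib]
    refine Eq.trans (Finset.sum_congr rfl ?_) hsum
    intro d _
    by_cases hd : d = c
    · subst hd
      have : h x = 0 := by simp [h, hPx]
      have : h y = 0 := by simp [h]
      rcases hxy with ⟨rfl, rfl⟩ | ⟨rfl, rfl⟩ <;> simp [*]
    -- Passing a crossing, the traveller changes the potential exactly when the strand crossed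
    -- belongs to the loop of `g`; the sign of the change is the direction of the crossing.
    · have e1 : F (D.left d) - F (D.next.symm (D.left d)) = - g (D.right d) := by
        simp only [F]
        rw [faceOf_top, ← faceOf_west, hφ' (D.right d)]
        ring
      have e2 : F (D.right d) - F (D.next.symm (D.right d)) = g (D.left d) := by
        simp only [F]
        rw [faceOf_west, ← faceOf_bottom, hφ', hgsymm _ (hdc d hd).1.1 (hdc d hd).1.2]
        ring
      rw [e1, e2]
      simp only [h, g, ite_and]
      split_ifs <;> first | (exfalso; omega) | simp
  · intro z hz
    have : F (D.next.symm z) = F z := by simp only [F]; rw [faceOf_mark D hz]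
    rw [this, sub_self, mul_zero]

/-- The signed count of the crossings at which the half of a planar knot diagram before a crossing
runs over the other half is the count of those at which it runs under. -/
theorem Planar.half_linking (hD : D.Planar) (hK : D.IsKnot) {c : D.C} {x y : D.X}
    (hxy : (x = D.left c ∧ y = D.right c) ∨ (x = D.right c ∧ y = D.left c)) :
    ∑ d, (if D.next.stepsFrom x (D.overPt d) < D.next.stepsFrom x y ∧
        D.next.stepsFrom x y < D.next.stepsFrom x (D.underPt d) then D.sign d else 0) =
      ∑ d, (if D.next.stepsFrom x (D.underPt d) < D.next.stepsFrom x y ∧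
        D.next.stepsFrom x y < D.next.stepsFrom x (D.overPt d) then D.sign d else 0) := by
  have h := hD.half_crossings hK hxy
  rw [← sub_eq_zero, ← Finset.sum_sub_distrib] at h ⊢
  rw [← Int.cast_inj (α := ℚ), Int.cast_zero, ← h, Int.cast_sum]
  apply Finset.sum_congr rfl
  intro d _
  -- At a negative crossing over and under exchange the roles of left and right, and the sign -1
  -- compensates for this in the difference of the two counts.
  unfold overPt underPt sign
  cases D.positive d
  · simp only [Bool.false_eq_true, if_false]
    push_cast
    split_ifs <;> simp
  · simp

end LinkDiagram

/-! ### Cycles of a permutation composed with a transposition -/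

namespace Equiv.Perm

variable {X Y : Type*} {f : Perm X}

/-- On a finite set forward steps exhaust a cycle, so stability under `f` alone suffices. -/
theorem SameCycle.pred_of_forall [Finite X] {p : X → Prop} (hp : ∀ z, p z → p (f z)) {x y : X}
    (h : f.SameCycle x y) (hx : p x) : p y := by
  obtain ⟨k, -, rfl⟩ := h.exists_pow_eq'
  induction k with
  | zero => exact hx
  | succ k ih =>
    rw [pow_succ_apply']
    exact hp _ (ih (sameCycle_pow_right.2 (SameCycle.refl f x)))

theorem SameCycle.map_of_forall [Finite X] {f' : Perm Y} {g : X → Y}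
    (hg : ∀ x, f'.SameCycle (g x) (g (f x))) {x y : X} (h : f.SameCycle x y) :
    f'.SameCycle (g x) (g y) :=
  h.pred_of_forall (p := fun z => f'.SameCycle (g x) (g z)) (fun z hz => hz.trans (hg z))
    (SameCycle.refl _ _)

theorem sameCycle_apply_self (x : X) : f.SameCycle x (f x) :=
  sameCycle_apply_right.2 (SameCycle.refl f x)

variable [DecidableEq X]

theorem sameCycle_swap_apply (x z : X) : f.SameCycle z (swap x (f x) z) := by
  rw [swap_apply_def]
  split_ifs with h1 h2
  · rw [h1]; exact sameCycle_apply_self x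
  · rw [h2]; exact (sameCycle_apply_self x).symm
  · exact SameCycle.refl _ _

/-- Exchanging the images of two points in different cycles joins the cycles. -/
theorem sameCycle_mul_swap_of_not [Finite X] {x y z : X} (hxy : ¬ f.SameCycle x y)
    (hz : f.SameCycle y z) : (f * swap x y).SameCycle x z := by
  obtain ⟨k, hk, -, rfl⟩ := hz.exists_pow_eq''
  obtain ⟨k, rfl⟩ := Nat.exists_eq_succ_of_ne_zero hk.ne'
  clear hk hz
  have h0 : (f * swap x y).SameCycle x (f y) := by
    have := sameCycle_apply_self (f := f * swap x y) x
    simpa using this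
  induction k with
  | zero => simpa using h0
  | succ k ih =>
    rw [Nat.succ_eq_add_one, pow_succ_apply']
    set w := (f ^ (k.succ)) y with hw
    have hyw : f.SameCycle y w := sameCycle_pow_right.2 (SameCycle.refl f y)
    by_cases h : w = y
    · rw [h]; exact h0
    · have hx : w ≠ x := fun e => hxy (by rw [← e]; exact hyw.symm)
      have := ih.trans (sameCycle_apply_self w)
      rwa [mul_apply, swap_apply_of_ne_of_ne hx h] at this

/-- Exchanging the images of two points in one cycle does not join it to other cycles. -/
theorem sameCycle_of_mul_swap [Finite X] {x y z : X} (hxy : f.SameCycle x y)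
    (hz : (f * swap x y).SameCycle x z) : f.SameCycle x z := by
  refine hz.pred_of_forall (p := fun z => f.SameCycle x z) (fun w hw => ?_) (SameCycle.refl f x)
  rw [mul_apply, swap_apply_def]
  split_ifs
  · exact sameCycle_apply_right.2 hxy
  · exact sameCycle_apply_self x
  · exact sameCycle_apply_right.2 hw

section Split

variable [Finite X] {x y : X} (hb : ∀ z, f.SameCycle x z)
include hb

/-- The new permutation sends `x` to `f y` and `y` to `f x`. So the cycle splits at `x` and `y`: the
points after `y` close up with `x`, and those between `x` and `y` close up with `y`
(`sameCycle_mul_swap_of_lt`). -/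
theorem sameCycle_mul_swap_of_gt {z : X} (hz : f.stepsFrom x y < f.stepsFrom x z) :
    (f * swap x y).SameCycle x z := by
  obtain ⟨k, hk⟩ := Nat.exists_eq_add_of_lt hz
  clear hz
  induction k generalizing z with
  | zero =>
    have hzx : z ≠ x := by rintro rfl; simp at hk
    have h1 := stepsFrom_symm hb hzx
    have h2 : f.symm z = y := stepsFrom_injective hb (by omega)
    have := sameCycle_apply_self (f := f * swap x y) x
    rwa [mul_apply, swap_apply_left, (f.symm_apply_eq).1 h2 |>.symm] at this
  | succ k ih =>
    have hzx : z ≠ x := by rintro rfl; simp at hk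
    have h1 := stepsFrom_symm hb hzx
    have h2 : f.symm z ≠ y := by intro e; rw [e] at h1; omega
    have h3 : f.symm z ≠ x := by intro e; rw [e] at h1; simp at h1; omega
    have := (ih (z := f.symm z) (by omega)).trans (sameCycle_apply_self _)
    rwa [mul_apply, swap_apply_of_ne_of_ne h3 h2, apply_symm_apply] at this

theorem sameCycle_mul_swap_of_lt {z : X} (hzx : z ≠ x)
    (hz : f.stepsFrom x z < f.stepsFrom x y) : (f * swap x y).SameCycle y z := by
  obtain ⟨k, hk⟩ := Nat.exists_eq_succ_of_ne_zero (stepsFrom_pos hb hzx).ne'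
  induction k generalizing z with
  | zero =>
    have h1 := stepsFrom_symm hb hzx
    have h2 : f.symm z = x := stepsFrom_injective hb (by simp; omega)
    have := sameCycle_apply_self (f := f * swap x y) y
    rwa [mul_apply, swap_apply_right, (f.symm_apply_eq).1 h2 |>.symm] at this
  | succ k ih =>
    have h1 := stepsFrom_symm hb hzx
    have h2 : f.symm z ≠ y := by intro e; rw [e] at h1; omega
    have h3 : f.symm z ≠ x := by intro e; rw [e] at h1; simp at h1; omega
    have := (ih h3 (by omega) (by omega)).trans (sameCycle_apply_self _)
    rwa [mul_apply, swap_apply_of_ne_of_ne h3 h2, apply_symm_apply] at this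

-- The set consisting of `x` and the points after `y` is stable under the new permutation and does
-- not contain `y`.
theorem not_sameCycle_mul_swap (hxy : x ≠ y) : ¬ (f * swap x y).SameCycle x y := by
  intro h
  have key := h.pred_of_forall (p := fun z => z = x ∨ f.stepsFrom x y < f.stepsFrom x z) ?_
    (Or.inl rfl)
  · simp [hxy.symm] at key
  · rintro z (rfl | hz)
    · rw [mul_apply, swap_apply_left]
      refine or_iff_not_imp_left.2 fun h => ?_
      rw [stepsFrom_apply hb h]
      omega
    · have h1 : z ≠ x := by rintro rfl; simp at hz
      have h2 : z ≠ y := by rintro rfl; simp at hz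
      rw [mul_apply, swap_apply_of_ne_of_ne h1 h2]
      refine or_iff_not_imp_left.2 fun h => ?_
      rw [stepsFrom_apply hb h]
      omega

theorem sameCycle_mul_swap_iff (hxy : x ≠ y) {z w : X} (hzx : z ≠ x) (hzy : z ≠ y)
    (hwx : w ≠ x) (hwy : w ≠ y) : (f * swap x y).SameCycle z w ↔
      (f.stepsFrom x z < f.stepsFrom x y ↔ f.stepsFrom x w < f.stepsFrom x y) := by
  have hz' : f.stepsFrom x z ≠ f.stepsFrom x y := fun e => hzy (stepsFrom_injective hb e)
  have hw' : f.stepsFrom x w ≠ f.stepsFrom x y := fun e => hwy (stepsFrom_injective hb e)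
  have hn := not_sameCycle_mul_swap hb hxy
  rcases lt_or_gt_of_ne hz' with hz | hz <;> rcases lt_or_gt_of_ne hw' with hw | hw
  · simp only [hz, hw, iff_self, iff_true]
    exact (sameCycle_mul_swap_of_lt hb hzx hz).symm.trans (sameCycle_mul_swap_of_lt hb hwx hw)
  · simp only [hz, hw.le.not_gt, iff_false, not_true_eq_false]
    intro h
    exact hn ((sameCycle_mul_swap_of_gt hb hw).trans (h.symm.trans
      (sameCycle_mul_swap_of_lt hb hzx hz).symm))
  · simp only [hw, hz.le.not_gt, false_iff, not_true, iff_false]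
    intro h
    exact hn ((sameCycle_mul_swap_of_gt hb hz).trans (h.trans
      (sameCycle_mul_swap_of_lt hb hwx hw).symm))
  · simp only [hz.le.not_gt, hw.le.not_gt, iff_self, iff_true]
    exact (sameCycle_mul_swap_of_gt hb hz).symm.trans (sameCycle_mul_swap_of_gt hb hw)

end Split

end Equiv.Perm

namespace LinkDiagram

open Equiv.Perm

variable {D : LinkDiagram}

/-! ### Points of crossings -/

theorem overPt_cases (c : D.C) : (D.overPt c = D.left c ∧ D.underPt c = D.right c) ∨
    (D.overPt c = D.right c ∧ D.underPt c = D.left c) := by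
  unfold overPt underPt
  cases D.positive c <;> simp

theorem overPt_injective : Function.Injective D.overPt := fun c d h => by
  rcases overPt_cases c with ⟨h1, -⟩ | ⟨h1, -⟩ <;> rcases overPt_cases d with ⟨h2, -⟩ | ⟨h2, -⟩ <;>
    rw [h1, h2] at h
  · exact D.left_injective h
  · exact (D.left_ne_right _ _ h).elim
  · exact (D.left_ne_right _ _ h.symm).elim
  · exact D.right_injective h

theorem underPt_injective : Function.Injective D.underPt := fun c d h => by
  rcases overPt_cases c with ⟨-, h1⟩ | ⟨-, h1⟩ <;> rcases overPt_cases d with ⟨-, h2⟩ | ⟨-, h2⟩ <;>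
    rw [h1, h2] at h
  · exact D.right_injective h
  · exact (D.left_ne_right _ _ h.symm).elim
  · exact (D.left_ne_right _ _ h).elim
  · exact D.left_injective h

theorem overPt_ne_underPt (c d : D.C) : D.overPt c ≠ D.underPt d := fun h => by
  have : c = d := by
    rcases overPt_cases c with ⟨h1, -⟩ | ⟨h1, -⟩ <;>
      rcases overPt_cases d with ⟨-, h2⟩ | ⟨-, h2⟩ <;> rw [h1, h2] at h
    · exact (D.left_ne_right _ _ h).elim
    · exact D.left_injective h
    · exact D.right_injective h
    · exact (D.left_ne_right _ _ h.symm).elim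
  subst this
  have := D.left_ne_right c c
  rcases overPt_cases c with ⟨h1, h2⟩ | ⟨h1, h2⟩ <;> rw [h1, h2] at h
  · exact this h
  · exact this h.symm

/-! ### The invariants of low degree -/

variable (D) in
/-- The diagram has two components. -/
def HasTwoComponents : Prop :=
  ∃ x y, ¬ D.next.SameCycle x y ∧ ∀ z, D.next.SameCycle x z ∨ D.next.SameCycle y z

open Classical in
variable (D) in
/-- The sum of the signs of the crossings between different components: for two components this is
twice the linking number. -/
noncomputable def totalLinking : ℤ :=
  ∑ c, if D.next.SameCycle (D.left c) (D.right c) then 0 else D.sign c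

variable (D) in
/-- From the base point `b` on, one passes first under `c`, then over `d`, then over `c`, then
under `d`. -/
def Interlaced (b : D.X) (c d : D.C) : Prop :=
  D.next.stepsFrom b (D.underPt c) < D.next.stepsFrom b (D.overPt d) ∧
    D.next.stepsFrom b (D.overPt d) < D.next.stepsFrom b (D.overPt c) ∧
      D.next.stepsFrom b (D.overPt c) < D.next.stepsFrom b (D.underPt d)

open Classical in
variable (D) in
/-- The Gauss diagram formula of Polyak and Viro for the Casson invariant of a knot. -/
noncomputable def casson (b : D.X) : ℤ :=
  ∑ c, ∑ d, if D.Interlaced b c d then D.sign c * D.sign d else 0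

-- In an interlaced pair the first and the last of the four points are under-points. Moving the base
-- point past `b` sends `b` from the first place to the last, so only pairs in which `b` is an
-- under-point can change. If `b` lies under `c`, the pairs lost have `c` first and the pairs gained
-- have `c` last; their signed counts agree by `Planar.half_linking` at `c`.
open Classical in
theorem Planar.casson_next (hD : D.Planar) (hK : D.IsKnot) (b : D.X) :
    D.casson (D.next b) = D.casson b := by
  have hb : ∀ z, D.next.SameCycle b z := hK.sameCycle b
  have h1 : ∀ z, z ≠ b → D.next.stepsFrom (D.next b) z + 1 = D.next.stepsFrom b z :=
    fun z hz => stepsFrom_apply_base hb hz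
  have h2 : ∀ z, z ≠ b → D.next.stepsFrom (D.next b) z < D.next.stepsFrom (D.next b) b :=
    fun z hz => stepsFrom_apply_base_lt hb hz
  have h0 : D.next.stepsFrom b b = 0 := stepsFrom_self
  have hover : ∀ c d, D.Interlaced (D.next b) c d → D.overPt c ≠ b ∧ D.overPt d ≠ b := by
    rintro c d ⟨i1, i2, i3⟩
    constructor
    · intro e
      rw [e] at i3
      by_cases e2 : D.underPt d = b
      · rw [e2] at i3; omega
      · have := h2 _ e2; omega
    · intro e
      rw [e] at i2
      by_cases e2 : D.overPt c = b
      · rw [e2] at i2; omega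
      · have := h2 _ e2; omega
  have hover' : ∀ c d, D.Interlaced b c d → D.overPt c ≠ b ∧ D.overPt d ≠ b := by
    rintro c d ⟨i1, i2, i3⟩
    constructor
    · intro e
      rw [e, h0] at i2
      omega
    · intro e
      rw [e, h0] at i1
      omega
  have hgen : ∀ c d, D.underPt c ≠ b → D.underPt d ≠ b →
      (D.Interlaced (D.next b) c d ↔ D.Interlaced b c d) := by
    intro c d hc hd
    have key : D.overPt c ≠ b → D.overPt d ≠ b →
        (D.Interlaced (D.next b) c d ↔ D.Interlaced b c d) := by
      intro e1 e2
      have := h1 _ hc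
      have := h1 _ hd
      have := h1 _ e1
      have := h1 _ e2
      unfold Interlaced
      omega
    exact ⟨fun h => (key (hover c d h).1 (hover c d h).2).1 h,
      fun h => (key (hover' c d h).1 (hover' c d h).2).2 h⟩
  by_cases hu : ∃ c, D.underPt c = b
  · obtain ⟨c, hc⟩ := hu
    have hover_ne : ∀ d, D.overPt d ≠ b := fun d e => overPt_ne_underPt d c (e.trans hc.symm)
    have hunder_ne : ∀ d, d ≠ c → D.underPt d ≠ b := fun d hd e =>
      hd (underPt_injective (e.trans hc.symm))
    have hbal := hD.half_linking hK (c := c) (x := b) (y := D.overPt c) (by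
      rcases overPt_cases c with ⟨e1, e2⟩ | ⟨e1, e2⟩
      · right; exact ⟨by rw [← hc, e2], e1⟩
      · left; exact ⟨by rw [← hc, e2], e1⟩)
    have hpos : ∀ d, 0 < D.next.stepsFrom b (D.overPt d) := fun d => stepsFrom_pos hb (hover_ne d)
    -- The new term plus the pairs lost equals the old term plus the pairs gained.
    have hterm : ∀ d e, (if D.Interlaced (D.next b) d e then D.sign d * D.sign e else 0) +
        (if d = c then D.sign c * (if
          D.next.stepsFrom b (D.overPt e) < D.next.stepsFrom b (D.overPt c) ∧
          D.next.stepsFrom b (D.overPt c) < D.next.stepsFrom b (D.underPt e) then D.sign e else 0)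
          else 0) =
        (if D.Interlaced b d e then D.sign d * D.sign e else 0) +
        (if e = c then D.sign c * (if
          D.next.stepsFrom b (D.underPt d) < D.next.stepsFrom b (D.overPt c) ∧
          D.next.stepsFrom b (D.overPt c) < D.next.stepsFrom b (D.overPt d) then D.sign d else 0)
          else 0) := by
      intro d e
      by_cases hd : d = c
      · by_cases he : e = c
        · rw [hd, he]
          have e1 : ¬ D.Interlaced b c c := fun h => absurd h.2.1 (lt_irrefl _)
          have e2 : ¬ D.Interlaced (D.next b) c c := fun h => absurd h.2.1 (lt_irrefl _)
          simp [e1, e2]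
        · have e2 : ¬ D.Interlaced (D.next b) d e := by
            rintro ⟨i, -, -⟩
            rw [hd, hc] at i
            have := h2 _ (hover_ne e)
            omega
          have e1 : D.Interlaced b d e ↔
              D.next.stepsFrom b (D.overPt e) < D.next.stepsFrom b (D.overPt c) ∧
              D.next.stepsFrom b (D.overPt c) < D.next.stepsFrom b (D.underPt e) := by
            unfold Interlaced
            rw [hd, hc, h0]
            simp [hpos e]
          rw [if_neg e2, if_pos hd, if_neg he, if_congr e1 rfl rfl, hd]
          split_ifs <;> simp
      · by_cases he : e = c
        · have e2 : ¬ D.Interlaced b d e := by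
            rintro ⟨-, -, i⟩
            rw [he, hc, h0] at i
            omega
          have e1 : D.Interlaced (D.next b) d e ↔
              D.next.stepsFrom b (D.underPt d) < D.next.stepsFrom b (D.overPt c) ∧
              D.next.stepsFrom b (D.overPt c) < D.next.stepsFrom b (D.overPt d) := by
            have := h1 _ (hover_ne c)
            have := h1 _ (hover_ne d)
            have := h1 _ (hunder_ne d hd)
            have := h2 _ (hover_ne d)
            unfold Interlaced
            rw [he, hc]
            omega
          rw [if_neg e2, if_neg hd, if_pos he, if_congr e1 rfl rfl, he]
          split_ifs <;> simp [mul_comm]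
        · simp only [hgen d e (hunder_ne d hd) (hunder_ne e he), hd, he, if_false]
    have hsum := Finset.sum_congr (rfl : (Finset.univ : Finset D.C) = Finset.univ) fun d _ =>
      Finset.sum_congr (rfl : (Finset.univ : Finset D.C) = Finset.univ) fun e _ => hterm d e
    simp only [Finset.sum_add_distrib] at hsum
    rw [Finset.sum_comm (f := fun d e => if d = c then _ else _)] at hsum
    simp only [Finset.sum_ite_eq', Finset.mem_univ, if_true, ← Finset.mul_sum] at hsum
    rw [hbal] at hsum
    unfold casson
    linarith
  · push Not at hu
    unfold casson
    refine Finset.sum_congr rfl fun c _ => Finset.sum_congr rfl fun d _ => ?_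
    simp only [hgen c d (hu c) (hu d)]

/-- The Casson invariant of a planar knot diagram does not depend on the base point. -/
theorem Planar.casson_eq (hD : D.Planar) (hK : D.IsKnot) (b b' : D.X) :
    D.casson b = D.casson b' :=
  (hK.sameCycle b b').pred_of_forall (p := fun z => D.casson b = D.casson z)
    (fun z hz => hz.trans (hD.casson_next hK z).symm) rfl

end LinkDiagram

namespace LinkDiagram

open Equiv.Perm

variable {D : LinkDiagram}

/-! ### Crossing changes and smoothings -/

theorem sum_erase {M : Type*} [AddCommMonoid M] (S : Set D.C) (f : D.C → M)
    (hf : ∀ c ∈ S, f c = 0) : ∑ c : (D.erase S).C, f c.1 = ∑ c, f c := by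
  apply Fintype.sum_of_injective (fun c : (D.erase S).C => c.1) Subtype.val_injective
  · intro c hc
    apply hf
    by_contra h
    exact hc ⟨⟨c, h⟩, rfl⟩
  · intro c
    rfl

section Sign

variable (c : D.C) (b : Bool)

theorem positive_withSign_self : (D.withSign c b).positive c = b := by
  simp [withSign]

theorem positive_withSign_of_ne {d : D.C} (h : d ≠ c) :
    (D.withSign c b).positive d = D.positive d := by
  simp [withSign, h]

theorem sign_withSign_of_ne {d : D.C} (h : d ≠ c) : (D.withSign c b).sign d = D.sign d := by
  unfold sign
  rw [positive_withSign_of_ne c b h]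

theorem overPt_withSign_of_ne {d : D.C} (h : d ≠ c) : (D.withSign c b).overPt d = D.overPt d := by
  unfold overPt
  rw [positive_withSign_of_ne c b h]
  rfl

theorem underPt_withSign_of_ne {d : D.C} (h : d ≠ c) :
    (D.withSign c b).underPt d = D.underPt d := by
  unfold underPt
  rw [positive_withSign_of_ne c b h]
  rfl

theorem sign_withSign_true : (D.withSign c true).sign c = 1 := by
  unfold sign
  rw [positive_withSign_self]
  rfl

theorem sign_withSign_false : (D.withSign c false).sign c = -1 := by
  unfold sign
  rw [positive_withSign_self]
  rfl

theorem points_withSign_true : (D.withSign c true).overPt c = D.left c ∧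
    (D.withSign c true).underPt c = D.right c := by
  unfold overPt underPt
  rw [positive_withSign_self]
  exact ⟨rfl, rfl⟩

theorem points_withSign_false : (D.withSign c false).overPt c = D.right c ∧
    (D.withSign c false).underPt c = D.left c := by
  unfold overPt underPt
  rw [positive_withSign_self]
  exact ⟨rfl, rfl⟩

end Sign

open Classical in
theorem totalLinking_withSign (c : D.C) : (D.withSign c true).totalLinking =
    (D.withSign c false).totalLinking +
      if D.next.SameCycle (D.left c) (D.right c) then 0 else 2 := by
  have h : ∀ d : D.C, (if D.next.SameCycle (D.left d) (D.right d) then 0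
      else (D.withSign c true).sign d) = (if D.next.SameCycle (D.left d) (D.right d) then 0
      else (D.withSign c false).sign d) +
      if d = c then (if D.next.SameCycle (D.left c) (D.right c) then 0 else 2) else 0 := by
    intro d
    by_cases hd : d = c
    · rw [hd, sign_withSign_true, sign_withSign_false, if_pos rfl]
      split_ifs <;> simp
    · rw [sign_withSign_of_ne c _ hd, sign_withSign_of_ne c _ hd, if_neg hd, add_zero]
  have hsum := Finset.sum_congr (rfl : (Finset.univ : Finset D.C) = Finset.univ) fun d _ => h d
  rw [Finset.sum_add_distrib, Finset.sum_ite_eq' Finset.univ c, if_pos (Finset.mem_univ c)] at hsum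
  exact hsum

-- With the base point at `D.left c`, a positive `c` starts with its over-point and is interlaced
-- with nothing. A negative `c` starts with its under-point and can only be the first crossing of a
-- pair, whose partners are the crossings `d` in the sum; each contributes `-D.sign d`.
open Classical in
theorem casson_withSign (hK : D.IsKnot) (c : D.C) : (D.withSign c true).casson (D.left c) =
    (D.withSign c false).casson (D.left c) +
      ∑ d, if D.next.stepsFrom (D.left c) (D.overPt d) < D.next.stepsFrom (D.left c) (D.right c) ∧
        D.next.stepsFrom (D.left c) (D.right c) < D.next.stepsFrom (D.left c) (D.underPt d)
        then D.sign d else 0 := by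
  have hb : ∀ z, D.next.SameCycle (D.left c) z := hK.sameCycle _
  have hI : ∀ b (d e : D.C), (D.withSign c b).Interlaced (D.left c) d e ↔
      D.next.stepsFrom (D.left c) ((D.withSign c b).underPt d) <
        D.next.stepsFrom (D.left c) ((D.withSign c b).overPt e) ∧
      D.next.stepsFrom (D.left c) ((D.withSign c b).overPt e) <
        D.next.stepsFrom (D.left c) ((D.withSign c b).overPt d) ∧
      D.next.stepsFrom (D.left c) ((D.withSign c b).overPt d) <
        D.next.stepsFrom (D.left c) ((D.withSign c b).underPt e) := fun _ _ _ => Iff.rfl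
  have hpos : ∀ d, d ≠ c → 0 < D.next.stepsFrom (D.left c) (D.overPt d) := by
    intro d hd
    apply stepsFrom_pos hb
    intro e
    rcases overPt_cases d with ⟨h, -⟩ | ⟨h, -⟩ <;> rw [h] at e
    · exact hd (D.left_injective e)
    · exact D.left_ne_right _ _ e.symm
  have h0 : D.next.stepsFrom (D.left c) (D.left c) = 0 := stepsFrom_self
  generalize D.next.stepsFrom (D.left c) = P at *
  have hterm : ∀ d e : D.C, (if (D.withSign c true).Interlaced (D.left c) d e then
        (D.withSign c true).sign d * (D.withSign c true).sign e else 0) =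
      (if (D.withSign c false).Interlaced (D.left c) d e then
        (D.withSign c false).sign d * (D.withSign c false).sign e else 0) +
      (if d = c then (if P (D.overPt e) <
          P (D.right c) ∧
        P (D.right c) < P (D.underPt e)
        then D.sign e else 0) else 0) := by
    intro d e
    by_cases hd : d = c
    · subst hd
      by_cases he : e = d
      · subst he
        have e1 : ∀ b, ¬ (D.withSign e b).Interlaced (D.left e) e e :=
          fun b h => absurd h.2.1 (lt_irrefl _)
        rw [if_neg (e1 _), if_neg (e1 _), if_pos rfl, if_neg, zero_add]
        rcases overPt_cases e with ⟨h1, h2⟩ | ⟨h1, h2⟩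
        · rw [h2]; exact fun h => absurd h.2 (lt_irrefl _)
        · rw [h1]; exact fun h => absurd h.1 (lt_irrefl _)
      · have e1 : ¬ (D.withSign d true).Interlaced (D.left d) d e := by
          intro i
          have i := ((hI _ _ _).1 i).2.1
          rw [(points_withSign_true d).1, h0] at i
          omega
        have e2 : (D.withSign d false).Interlaced (D.left d) d e ↔
            P (D.overPt e) < P (D.right d) ∧
            P (D.right d) <
              P (D.underPt e) := by
          rw [hI, (points_withSign_false d).1, (points_withSign_false d).2, h0,
            overPt_withSign_of_ne d _ he, underPt_withSign_of_ne d _ he]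
          simp [hpos e he]
        rw [if_neg e1, if_congr e2 rfl rfl, if_pos rfl, sign_withSign_false,
          sign_withSign_of_ne d _ he]
        split_ifs <;> simp
    · rw [if_neg hd, add_zero]
      by_cases he : e = c
      · subst he
        have e1 : ¬ (D.withSign e true).Interlaced (D.left e) d e := by
          intro i
          have i := ((hI _ _ _).1 i).1
          rw [(points_withSign_true e).1, h0] at i
          omega
        have e2 : ¬ (D.withSign e false).Interlaced (D.left e) d e := by
          intro i
          have i := ((hI _ _ _).1 i).2.2
          rw [(points_withSign_false e).2, h0] at i
          omega
        rw [if_neg e1, if_neg e2]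
      · simp only [hI, overPt_withSign_of_ne c _ hd, underPt_withSign_of_ne c _ hd,
          overPt_withSign_of_ne c _ he, underPt_withSign_of_ne c _ he,
          sign_withSign_of_ne c _ hd, sign_withSign_of_ne c _ he]
  have hsum := Finset.sum_congr (rfl : (Finset.univ : Finset D.C) = Finset.univ) fun d _ =>
    Finset.sum_congr (rfl : (Finset.univ : Finset D.C) = Finset.univ) fun e _ => hterm d e
  simp only [Finset.sum_add_distrib] at hsum
  rw [Finset.sum_comm (f := fun d e => if d = c then _ else _)] at hsum
  simp only [Finset.sum_ite_eq', Finset.mem_univ, if_true] at hsum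
  exact hsum

theorem smooth_next [DecidableEq D.X] (c : D.C) :
    (D.smooth c).next = D.next * Equiv.swap (D.left c) (D.right c) := by
  unfold smooth reroute erase
  congr!

-- The crossings between the two components of the smoothing are those with one point in each half.
-- Whether the first half runs over or under there, the signed counts agree by
-- `Planar.half_linking`, which yields the factor 2.
open Classical in
theorem totalLinking_smooth (hD : D.Planar) (hK : D.IsKnot) (c : D.C) :
    (D.smooth c).totalLinking = 2 *
      ∑ d, if D.next.stepsFrom (D.left c) (D.overPt d) < D.next.stepsFrom (D.left c) (D.right c) ∧
        D.next.stepsFrom (D.left c) (D.right c) < D.next.stepsFrom (D.left c) (D.underPt d)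
        then D.sign d else 0 := by
  have hb : ∀ z, D.next.SameCycle (D.left c) z := hK.sameCycle _
  have hbal := hD.half_linking hK (c := c) (Or.inl ⟨rfl, rfl⟩)
  rw [two_mul]
  -- Of the two equal summands, one is replaced by the other side of the balance, so that both kinds
  -- of mixed crossings appear.
  conv_rhs => rw [hbal]; lhs; rw [← hbal]
  rw [← Finset.sum_add_distrib, ← sum_erase {c}]
  · have key : ∀ d : D.C, d ≠ c →
        (if (D.next * Equiv.swap (D.left c) (D.right c)).SameCycle (D.left d) (D.right d)
          then 0 else D.sign d) =
        (if D.next.stepsFrom (D.left c) (D.overPt d) < D.next.stepsFrom (D.left c) (D.right c) ∧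
          D.next.stepsFrom (D.left c) (D.right c) < D.next.stepsFrom (D.left c) (D.underPt d)
          then D.sign d else 0) +
        (if D.next.stepsFrom (D.left c) (D.underPt d) < D.next.stepsFrom (D.left c) (D.right c) ∧
          D.next.stepsFrom (D.left c) (D.right c) < D.next.stepsFrom (D.left c) (D.overPt d)
          then D.sign d else 0) := by
      intro d hd
      have n1 : D.left d ≠ D.left c := fun h => hd (D.left_injective h)
      have n2 : D.right d ≠ D.right c := fun h => hd (D.right_injective h)
      have n3 : D.left d ≠ D.right c := D.left_ne_right _ _
      have n4 : D.right d ≠ D.left c := (D.left_ne_right _ _).symm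
      have p1 : D.next.stepsFrom (D.left c) (D.left d) ≠ D.next.stepsFrom (D.left c) (D.right c) :=
        fun h => n3 (stepsFrom_injective hb h)
      have p2 : D.next.stepsFrom (D.left c) (D.right d) ≠
          D.next.stepsFrom (D.left c) (D.right c) := fun h => n2 (stepsFrom_injective hb h)
      rw [if_congr (sameCycle_mul_swap_iff hb (D.left_ne_right c c) n1 n3 n4 n2) rfl rfl]
      rcases overPt_cases d with ⟨e1, e2⟩ | ⟨e1, e2⟩ <;> rw [e1, e2] <;>
        split_ifs <;> first | (exfalso; omega) | simp
    exact Finset.sum_congr rfl fun d _ => key d.1 d.2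
  · rintro d rfl
    rcases overPt_cases d with ⟨e1, e2⟩ | ⟨e1, e2⟩ <;> simp [e1, e2]

theorem hasTwoComponents_smooth (hK : D.IsKnot) (c : D.C) : (D.smooth c).HasTwoComponents := by
  classical
  have hb : ∀ z, D.next.SameCycle (D.left c) z := hK.sameCycle _
  unfold HasTwoComponents
  rw [smooth_next]
  refine ⟨D.left c, D.right c, not_sameCycle_mul_swap hb (D.left_ne_right c c), fun z => ?_⟩
  by_cases h1 : z = D.left c
  · rw [h1]; exact Or.inl (SameCycle.refl _ _)
  rcases lt_trichotomy (D.next.stepsFrom (D.left c) z) (D.next.stepsFrom (D.left c) (D.right c))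
    with h | h | h
  · exact Or.inr (sameCycle_mul_swap_of_lt hb h1 h)
  · rw [stepsFrom_injective hb h]; exact Or.inr (SameCycle.refl _ _)
  · exact Or.inl (sameCycle_mul_swap_of_gt hb h)

/-- Smoothing a crossing between the components merges them, whereas smoothing a self-crossing
cannot connect its component to the other one. -/
theorem isKnot_smooth_iff (hD : D.HasTwoComponents) (c : D.C) :
    (D.smooth c).IsKnot ↔ ¬ D.next.SameCycle (D.left c) (D.right c) := by
  classical
  obtain ⟨x, y, hxy, hz⟩ := hD
  unfold IsKnot
  rw [smooth_next]
  constructor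
  · rintro ⟨w, hw⟩ h
    have h1 : ∀ z, D.next.SameCycle (D.left c) z := fun z =>
      sameCycle_of_mul_swap h ((hw _).symm.trans (hw z))
    exact hxy ((h1 x).symm.trans (h1 y))
  · intro h
    refine ⟨D.left c, fun z => ?_⟩
    have h1 : ∀ z, D.next.SameCycle (D.right c) z →
        (D.next * Equiv.swap (D.left c) (D.right c)).SameCycle (D.left c) z :=
      fun z => sameCycle_mul_swap_of_not h
    have h2 : ∀ z, D.next.SameCycle (D.left c) z →
        (D.next * Equiv.swap (D.left c) (D.right c)).SameCycle (D.right c) z := fun z => by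
      rw [Equiv.swap_comm]
      exact sameCycle_mul_swap_of_not fun e => h e.symm
    have h3 := h1 _ (SameCycle.refl _ _)
    have h4 : D.next.SameCycle (D.left c) z ∨ D.next.SameCycle (D.right c) z := by
      rcases hz (D.left c) with e1 | e1 <;> rcases hz (D.right c) with e2 | e2
      · exact (h (e1.symm.trans e2)).elim
      · rcases hz z with e | e
        · exact Or.inl (e1.symm.trans e)
        · exact Or.inr (e2.symm.trans e)
      · rcases hz z with e | e
        · exact Or.inr (e2.symm.trans e)
        · exact Or.inl (e1.symm.trans e)
      · exact (h (e1.symm.trans e2)).elim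
    rcases h4 with e | e
    · exact h3.trans (h2 z e)
    · exact h1 z e

end LinkDiagram

namespace LinkDiagram

open Equiv.Perm

variable {D E : LinkDiagram}

/-! ### Invariance under the elementary moves -/

/-- A map of the points which induces a bijection of the components. -/
structure IsComponentMap (D E : LinkDiagram) (g : D.X → E.X) : Prop where
  sameCycle_iff : ∀ x y, E.next.SameCycle (g x) (g y) ↔ D.next.SameCycle x y
  exists_sameCycle : ∀ e, ∃ x, E.next.SameCycle (g x) e

theorem IsComponentMap.isKnot_iff {g : D.X → E.X} (h : IsComponentMap D E g) :
    E.IsKnot ↔ D.IsKnot := by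
  constructor
  · intro hE
    obtain ⟨e, he⟩ := hE
    obtain ⟨x, hx⟩ := h.exists_sameCycle e
    exact ⟨x, fun y => (h.sameCycle_iff x y).1 (hx.trans (he _))⟩
  · rintro ⟨x, hx⟩
    refine ⟨g x, fun e => ?_⟩
    obtain ⟨y, hy⟩ := h.exists_sameCycle e
    exact ((h.sameCycle_iff x y).2 (hx y)).trans hy

theorem IsComponentMap.hasTwoComponents_iff {g : D.X → E.X} (h : IsComponentMap D E g) :
    E.HasTwoComponents ↔ D.HasTwoComponents := by
  constructor
  · rintro ⟨e, f, hef, hz⟩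
    obtain ⟨x, hx⟩ := h.exists_sameCycle e
    obtain ⟨y, hy⟩ := h.exists_sameCycle f
    refine ⟨x, y, fun hxy => hef (hx.symm.trans (((h.sameCycle_iff x y).2 hxy).trans hy)),
      fun z => ?_⟩
    rcases hz (g z) with hz | hz
    · exact Or.inl ((h.sameCycle_iff x z).1 (hx.trans hz))
    · exact Or.inr ((h.sameCycle_iff y z).1 (hy.trans hz))
  · rintro ⟨x, y, hxy, hz⟩
    refine ⟨g x, g y, fun e => hxy ((h.sameCycle_iff x y).1 e), fun e => ?_⟩
    obtain ⟨z, hze⟩ := h.exists_sameCycle e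
    rcases hz z with hz | hz
    · exact Or.inl (((h.sameCycle_iff x z).2 hz).trans hze)
    · exact Or.inr (((h.sameCycle_iff y z).2 hz).trans hze)

variable (D E) in
/-- The invariants of low degree agree, where the Casson invariants are taken at suitable base
points. -/
structure SameInvariants : Prop where
  isKnot : E.IsKnot ↔ D.IsKnot
  hasTwoComponents : E.HasTwoComponents ↔ D.HasTwoComponents
  totalLinking : E.totalLinking = D.totalLinking
  casson : D.IsKnot → ∃ b b', E.casson b' = D.casson b

/-! #### Isomorphisms -/

theorem Iso.pow_next (e : Iso D E) (k : ℕ) (x : D.X) :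
    (E.next ^ k) (e.onX x) = e.onX ((D.next ^ k) x) := by
  induction k with
  | zero => rfl
  | succ k ih => rw [pow_succ_apply', pow_succ_apply', ih, e.next_comm]

theorem Iso.isComponentMap (e : Iso D E) : IsComponentMap D E e.onX where
  sameCycle_iff x y := by
    constructor
    · intro h
      obtain ⟨k, -, hk⟩ := h.exists_pow_eq'
      rw [e.pow_next] at hk
      rw [← e.onX.injective hk]
      exact sameCycle_pow_right.2 (SameCycle.refl _ _)
    · intro h
      refine h.map_of_forall fun x => ?_
      rw [e.next_comm]
      exact sameCycle_apply_self _
  exists_sameCycle x := ⟨e.onX.symm x, by simpa using SameCycle.refl _ _⟩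

theorem Iso.stepsFrom (e : Iso D E) (b x : D.X) :
    E.next.stepsFrom (e.onX b) (e.onX x) = D.next.stepsFrom b x := by
  unfold Equiv.Perm.stepsFrom
  simp only [e.pow_next, EmbeddingLike.apply_eq_iff_eq]

theorem Iso.overPt (e : Iso D E) (c : D.C) : E.overPt (e.onC c) = e.onX (D.overPt c) := by
  unfold LinkDiagram.overPt
  rw [← e.positive_comm, ← e.left_comm, ← e.right_comm, apply_ite e.onX]

theorem Iso.underPt (e : Iso D E) (c : D.C) : E.underPt (e.onC c) = e.onX (D.underPt c) := by
  unfold LinkDiagram.underPt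
  rw [← e.positive_comm, ← e.left_comm, ← e.right_comm, apply_ite e.onX]

theorem Iso.sign (e : Iso D E) (c : D.C) : E.sign (e.onC c) = D.sign c := by
  unfold LinkDiagram.sign
  rw [← e.positive_comm]

theorem Iso.interlaced (e : Iso D E) (b : D.X) (c d : D.C) :
    E.Interlaced (e.onX b) (e.onC c) (e.onC d) ↔ D.Interlaced b c d := by
  unfold Interlaced
  simp only [e.overPt, e.underPt, e.stepsFrom]

theorem Iso.sameInvariants (e : Iso D E) : SameInvariants D E where
  isKnot := e.isComponentMap.isKnot_iff
  hasTwoComponents := e.isComponentMap.hasTwoComponents_iff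
  totalLinking := by
    classical
    unfold LinkDiagram.totalLinking
    symm
    refine Fintype.sum_equiv e.onC _ _ fun c => ?_
    rw [← e.left_comm, ← e.right_comm, e.sign]
    simp only [e.isComponentMap.sameCycle_iff]
  casson := by
    rintro ⟨b, -⟩
    refine ⟨b, e.onX b, ?_⟩
    classical
    unfold LinkDiagram.casson
    symm
    refine Fintype.sum_equiv e.onC _ _ fun c => Fintype.sum_equiv e.onC _ _ fun d => ?_
    rw [e.sign, e.sign]
    exact if_congr (e.interlaced b c d).symm rfl rfl

/-! #### Marks -/

section Mark

variable (D) (x : D.X)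

/-- A point of `D` as a point of the diagram with one more mark. -/
def oldPoint (z : D.X) : (D.addMark x).X := some z

/-- The new mark. -/
def newPoint : (D.addMark x).X := none

/-- The tail of the edge of `D` on which a point of the diagram with one more mark lies. -/
def forgetMark (z : (D.addMark x).X) : D.X := Option.getD z x

theorem forgetMark_new : D.forgetMark x (D.newPoint x) = x := rfl

theorem forgetMark_old (z : D.X) : D.forgetMark x (D.oldPoint x z) = z := rfl

theorem oldPoint_injective : Function.Injective (D.oldPoint x) := Option.some_injective _

theorem addMark_cases (z : (D.addMark x).X) : z = D.newPoint x ∨ ∃ w, z = D.oldPoint x w :=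
  match z with
  | none => Or.inl rfl
  | some w => Or.inr ⟨w, rfl⟩

theorem addMark_next_new : (D.addMark x).next (D.newPoint x) = D.oldPoint x (D.next x) := by
  classical
  change (Equiv.optionCongr D.next) (Equiv.swap none (some x) none) = some (D.next x)
  rw [Equiv.swap_apply_left]
  rfl

theorem addMark_next_self : (D.addMark x).next (D.oldPoint x x) = D.newPoint x := by
  classical
  change (Equiv.optionCongr D.next) (Equiv.swap none (some x) (some x)) = none
  rw [Equiv.swap_apply_right]
  rfl

theorem addMark_next_of_ne {z : D.X} (hz : z ≠ x) :
    (D.addMark x).next (D.oldPoint x z) = D.oldPoint x (D.next z) := by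
  classical
  change (Equiv.optionCongr D.next) (Equiv.swap none (some x) (some z)) = some (D.next z)
  rw [Equiv.swap_apply_of_ne_of_ne (by simp) (by simpa using hz)]
  rfl

instance : Finite (D.addMark x).X := (D.addMark x).finite_X

theorem isComponentMap_addMark : IsComponentMap D (D.addMark x) (D.oldPoint x) where
  sameCycle_iff y z := by
    constructor
    · intro h
      refine h.map_of_forall (f' := D.next) (g := D.forgetMark x) ?_
      intro w
      rcases addMark_cases D x w with rfl | ⟨w, rfl⟩
      · rw [addMark_next_new, forgetMark_new, forgetMark_old]
        exact sameCycle_apply_self _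
      · by_cases hw : w = x
        · rw [hw, addMark_next_self, forgetMark_new, forgetMark_old]
        · rw [addMark_next_of_ne D x hw, forgetMark_old, forgetMark_old]
          exact sameCycle_apply_self _
    · intro h
      refine h.map_of_forall fun w => ?_
      by_cases hw : w = x
      · have h1 := sameCycle_apply_self (f := (D.addMark x).next) (D.oldPoint x x)
        have h2 := sameCycle_apply_self (f := (D.addMark x).next) (D.newPoint x)
        rw [addMark_next_self] at h1
        rw [addMark_next_new] at h2
        rw [hw]
        exact h1.trans h2
      · rw [← addMark_next_of_ne D x hw]
        exact sameCycle_apply_self _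
  exists_sameCycle w := by
    rcases addMark_cases D x w with rfl | ⟨w, rfl⟩
    · refine ⟨x, ?_⟩
      have h1 := sameCycle_apply_self (f := (D.addMark x).next) (D.oldPoint x x)
      rwa [addMark_next_self] at h1
    · exact ⟨w, SameCycle.refl _ _⟩

/-- Counted from `D.next x`, the new mark comes last, so no position of an old point shifts. -/
theorem addMark_stepsFrom (hK : D.IsKnot) (z : D.X) :
    (D.addMark x).next.stepsFrom (D.oldPoint x (D.next x)) (D.oldPoint x z) =
      D.next.stepsFrom (D.next x) z := by
  have hb : ∀ z, D.next.SameCycle (D.next x) z := hK.sameCycle _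
  have hbE : ∀ z, (D.addMark x).next.SameCycle (D.oldPoint x (D.next x)) z :=
    ((isComponentMap_addMark D x).isKnot_iff.2 hK).sameCycle _
  have hpow : ∀ k ≤ D.next.stepsFrom (D.next x) z,
      ((D.addMark x).next ^ k) (D.oldPoint x (D.next x)) =
        D.oldPoint x ((D.next ^ k) (D.next x)) := by
    intro k hk
    induction k with
    | zero => rfl
    | succ k ih =>
      rw [pow_succ_apply', pow_succ_apply', ih (by omega), addMark_next_of_ne]
      -- If the walk stood at `x`, its next step would close the cycle, and `z` would have been met
      -- already.
      intro e
      have := stepsFrom_lt_of_pow_eq hb (m := k + 1) (Nat.succ_pos k)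
        (by rw [pow_succ_apply', e]) z
      omega
  apply le_antisymm
  · apply stepsFrom_le
    rw [hpow _ le_rfl, pow_stepsFrom hb]
  · by_contra hlt
    push Not at hlt
    have h1 := pow_stepsFrom hbE (D.oldPoint x z)
    rw [hpow _ hlt.le] at h1
    have := stepsFrom_le (D.oldPoint_injective x h1)
    omega

theorem addMark_overPt (c : D.C) : (D.addMark x).overPt c = D.oldPoint x (D.overPt c) :=
  (apply_ite some _ _ _).symm

theorem addMark_underPt (c : D.C) : (D.addMark x).underPt c = D.oldPoint x (D.underPt c) :=
  (apply_ite some _ _ _).symm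

theorem sameInvariants_addMark : SameInvariants D (D.addMark x) where
  isKnot := (isComponentMap_addMark D x).isKnot_iff
  hasTwoComponents := (isComponentMap_addMark D x).hasTwoComponents_iff
  totalLinking := by
    classical
    refine Finset.sum_congr rfl fun c _ => ?_
    exact if_congr ((isComponentMap_addMark D x).sameCycle_iff _ _) rfl rfl
  casson := by
    intro hK
    refine ⟨D.next x, D.oldPoint x (D.next x), ?_⟩
    classical
    have key : ∀ c d : D.C, (D.addMark x).Interlaced (D.oldPoint x (D.next x)) c d ↔
        D.Interlaced (D.next x) c d := by
      intro c d
      unfold Interlaced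
      rw [addMark_overPt, addMark_overPt, addMark_underPt, addMark_underPt]
      simp only [addMark_stepsFrom D x hK]
    exact Finset.sum_congr rfl fun c _ => Finset.sum_congr rfl fun d _ =>
      if_congr (key c d) rfl rfl

end Mark

/-! #### Erasing crossings -/

theorem casson_erase (S : Set D.C) (b : D.X)
    (h : ∀ c ∈ S, ∀ d, ¬ D.Interlaced b c d ∧ ¬ D.Interlaced b d c) :
    (D.erase S).casson b = D.casson b := by
  classical
  unfold casson
  rw [← sum_erase S (fun c => ∑ d, if D.Interlaced b c d then D.sign c * D.sign d else 0)]
  · refine Finset.sum_congr rfl fun c _ => ?_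
    rw [← sum_erase S (fun d => if D.Interlaced b c.1 d then D.sign c.1 * D.sign d else 0)]
    · rfl
    · intro d hd
      rw [if_neg (h d hd c.1).2]
  · intro c hc
    exact Finset.sum_eq_zero fun d _ => by rw [if_neg (h c hc d).1]

/-- No crossing whose over-strand is among the first two points after an over-crossing base point
is interlaced. -/
theorem not_interlaced {b : D.X} (hK : D.IsKnot) {e : D.C} (hb : D.overPt e = b) {c : D.C}
    (hc : D.next.stepsFrom b (D.overPt c) ≤ 1) (d : D.C) :
    ¬ D.Interlaced b c d ∧ ¬ D.Interlaced b d c := by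
  -- The base point is an over-point, so under-points have positive positions, and an over-point of
  -- an interlaced pair has position at least two.
  have hpos : 0 < D.next.stepsFrom b (D.underPt d) :=
    stepsFrom_pos (hK.sameCycle b) fun h => overPt_ne_underPt e d (hb.trans h.symm)
  constructor
  · rintro ⟨h1, h2, -⟩
    omega
  · rintro ⟨h1, -, -⟩
    omega

theorem stepsFrom_apply_le (f : Equiv.Perm D.X) (b : D.X) : f.stepsFrom b (f b) ≤ 1 :=
  stepsFrom_le (by simp)

theorem Corner.points {c : D.C} {s t : D.X × Side} (h : D.Corner c s t) :
    ∃ p q, ((p = D.left c ∧ q = D.right c) ∨ (p = D.right c ∧ q = D.left c)) ∧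
      (p = s.1 ∨ p = D.next s.1) ∧ (q = t.1 ∨ q = D.next t.1) := by
  rcases h with (_ | _ | _ | _) | (_ | _ | _ | _)
  · exact ⟨_, _, Or.inl ⟨rfl, rfl⟩, by simp⟩
  · exact ⟨_, _, Or.inr ⟨rfl, rfl⟩, by simp⟩
  · exact ⟨_, _, Or.inl ⟨rfl, rfl⟩, by simp⟩
  · exact ⟨_, _, Or.inr ⟨rfl, rfl⟩, by simp⟩
  · exact ⟨_, _, Or.inr ⟨rfl, rfl⟩, by simp⟩
  · exact ⟨_, _, Or.inl ⟨rfl, rfl⟩, by simp⟩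
  · exact ⟨_, _, Or.inr ⟨rfl, rfl⟩, by simp⟩
  · exact ⟨_, _, Or.inl ⟨rfl, rfl⟩, by simp⟩

theorem EdgeOver.overPt_eq {x : D.X} (h : D.EdgeOver x) {c : D.C} {p : D.X}
    (hp : p = D.left c ∨ p = D.right c) (hx : p = x ∨ p = D.next x) : D.overPt c = p := by
  have h1 : ∃ e, D.overPt e = p := by
    rcases hx with rfl | rfl
    · exact h.1
    · exact h.2
  obtain ⟨e, he⟩ := h1
  have h2 : p = D.overPt c ∨ p = D.underPt c := by
    rcases overPt_cases c with ⟨e1, e2⟩ | ⟨e1, e2⟩ <;> rw [e1, e2]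
    · exact hp
    · exact hp.symm
  rcases h2 with h2 | h2
  · exact h2.symm
  · exact (overPt_ne_underPt e c (he.trans h2)).elim

theorem EdgeUnder.underPt_eq {x : D.X} (h : D.EdgeUnder x) {c : D.C} {p : D.X}
    (hp : p = D.left c ∨ p = D.right c) (hx : p = x ∨ p = D.next x) : D.underPt c = p := by
  have h1 : ∃ e, D.underPt e = p := by
    rcases hx with rfl | rfl
    · exact h.1
    · exact h.2
  obtain ⟨e, he⟩ := h1
  have h2 : p = D.overPt c ∨ p = D.underPt c := by
    rcases overPt_cases c with ⟨e1, e2⟩ | ⟨e1, e2⟩ <;> rw [e1, e2]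
    · exact hp
    · exact hp.symm
  rcases h2 with h2 | h2
  · exact (overPt_ne_underPt c e (he.trans h2).symm).elim
  · exact h2.symm

theorem Corner.of_edgeOver {c : D.C} {s t : D.X × Side} (h : D.Corner c s t)
    (hs : D.EdgeOver s.1) : (D.overPt c = s.1 ∨ D.overPt c = D.next s.1) ∧
      (D.underPt c = t.1 ∨ D.underPt c = D.next t.1) := by
  obtain ⟨p, q, hpq, hp, hq⟩ := h.points
  have h1 : D.overPt c = p := hs.overPt_eq (hpq.imp And.left And.left).symm.symm hp
  have h2 : D.underPt c = q := by
    have := D.left_ne_right c c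
    rcases overPt_cases c with ⟨e1, e2⟩ | ⟨e1, e2⟩ <;> rw [e2] <;> rw [e1] at h1 <;>
      rcases hpq with ⟨h3, h4⟩ | ⟨h3, h4⟩
    · exact h4.symm
    · exact (this (h1.trans h3)).elim
    · exact (this (h1.trans h3).symm).elim
    · exact h4.symm
  rw [h1, h2]
  exact ⟨hp, hq⟩

theorem Corner.of_edgeUnder {c : D.C} {s t : D.X × Side} (h : D.Corner c s t)
    (ht : D.EdgeUnder t.1) : (D.overPt c = s.1 ∨ D.overPt c = D.next s.1) ∧
      (D.underPt c = t.1 ∨ D.underPt c = D.next t.1) := by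
  obtain ⟨p, q, hpq, hp, hq⟩ := h.points
  have h1 : D.underPt c = q := ht.underPt_eq (hpq.imp And.right And.right).symm hq
  have h2 : D.overPt c = p := by
    have := D.left_ne_right c c
    rcases overPt_cases c with ⟨e1, e2⟩ | ⟨e1, e2⟩ <;> rw [e1] <;> rw [e2] at h1 <;>
      rcases hpq with ⟨h3, h4⟩ | ⟨h3, h4⟩
    · exact h3.symm
    · exact (this (h1.trans h4).symm).elim
    · exact (this (h1.trans h4)).elim
    · exact h3.symm
  rw [h1, h2]
  exact ⟨hp, hq⟩

/-- `1` on the right and `-1` on the left. -/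
def Side.sign : Side → ℤ
  | .L => -1
  | .R => 1

/-- This makes the two signs in the second Reidemeister move cancel: both corners of the bigon lie
on the same side of the under-edge, while the over-edge leaves one crossing and enters the other. -/
theorem Corner.sign_eq {c : D.C} {s t : D.X × Side} (h : D.Corner c s t)
    (hs : D.EdgeOver s.1) : (D.overPt c = s.1 ∧ D.sign c = Side.sign t.2) ∨
      (D.overPt c = D.next s.1 ∧ D.sign c = - Side.sign t.2) := by
  have hl : D.overPt c = D.left c → D.sign c = 1 := by
    intro h
    unfold overPt at h
    unfold LinkDiagram.sign
    split_ifs at h ⊢ with hp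
    · rfl
    · exact (D.left_ne_right c c h.symm).elim
  have hr : D.overPt c = D.right c → D.sign c = -1 := by
    intro h
    unfold overPt at h
    unfold LinkDiagram.sign
    split_ifs at h ⊢ with hp
    · exact (D.left_ne_right c c h).elim
    · rfl
  rcases h with (_ | _ | _ | _) | (_ | _ | _ | _)
  · have e := hs.overPt_eq (c := c) (p := D.left c) (Or.inl rfl) (Or.inr (by simp))
    exact Or.inr ⟨by simpa using e, hl e⟩
  · have e := hs.overPt_eq (c := c) (p := D.right c) (Or.inr rfl) (Or.inr (by simp))
    exact Or.inr ⟨by simpa using e, hr e⟩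
  · have e := hs.overPt_eq (c := c) (p := D.left c) (Or.inl rfl) (Or.inl rfl)
    exact Or.inl ⟨e, hl e⟩
  · have e := hs.overPt_eq (c := c) (p := D.right c) (Or.inr rfl) (Or.inl rfl)
    exact Or.inl ⟨e, hr e⟩
  · have e := hs.overPt_eq (c := c) (p := D.right c) (Or.inr rfl) (Or.inr (by simp))
    exact Or.inr ⟨by simpa using e, hr e⟩
  · have e := hs.overPt_eq (c := c) (p := D.left c) (Or.inl rfl) (Or.inl rfl)
    exact Or.inl ⟨e, hl e⟩
  · have e := hs.overPt_eq (c := c) (p := D.right c) (Or.inr rfl) (Or.inl rfl)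
    exact Or.inl ⟨e, hr e⟩
  · have e := hs.overPt_eq (c := c) (p := D.left c) (Or.inl rfl) (Or.inr (by simp))
    exact Or.inr ⟨by simpa using e, hl e⟩

theorem sameCycle_of_edge {x p : D.X} (h : p = x ∨ p = D.next x) : D.next.SameCycle x p := by
  rcases h with rfl | rfl
  · exact SameCycle.refl _ _
  · exact sameCycle_apply_self _

theorem stepsFrom_edge_le {x p : D.X} (h : p = x ∨ p = D.next x) :
    D.next.stepsFrom x p ≤ 1 := by
  rcases h with rfl | rfl
  · simp
  · exact stepsFrom_apply_le _ _

theorem sameCycle_iff_over_under (c : D.C) : D.next.SameCycle (D.left c) (D.right c) ↔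
    D.next.SameCycle (D.overPt c) (D.underPt c) := by
  rcases overPt_cases c with ⟨e1, e2⟩ | ⟨e1, e2⟩ <;> rw [e1, e2]
  exact sameCycle_comm

/-- Both points of the crossing are ends of one edge. So it is a self-crossing, and from the tail of
that edge no point fits between its two points, as interlacing would require. -/
theorem sameInvariants_r1 (c : D.C) (s : D.X × Side) (h : D.Corner c s s) :
    SameInvariants D (D.erase {c}) := by
  classical
  have key : (D.overPt c = s.1 ∨ D.overPt c = D.next s.1) ∧
      (D.underPt c = s.1 ∨ D.underPt c = D.next s.1) := by
    obtain ⟨p, q, hpq, hp, hq⟩ := h.points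
    rcases overPt_cases c with ⟨e1, e2⟩ | ⟨e1, e2⟩ <;> rw [e1, e2] <;>
      rcases hpq with ⟨rfl, rfl⟩ | ⟨rfl, rfl⟩ <;> simp only [hp, hq, and_self]
  refine ⟨Iff.rfl, Iff.rfl, ?_, fun hK => ⟨s.1, s.1, casson_erase _ _ ?_⟩⟩
  · refine sum_erase {c} (fun c => if D.next.SameCycle (D.left c) (D.right c) then 0
      else D.sign c) ?_
    rintro _ rfl
    rw [if_pos]
    rw [sameCycle_iff_over_under]
    exact (sameCycle_of_edge key.1).symm.trans (sameCycle_of_edge key.2)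
  · rintro _ rfl d
    have h1 := stepsFrom_edge_le key.1
    have h2 := stepsFrom_edge_le key.2
    constructor
    · rintro ⟨i, j, -⟩
      omega
    · rintro ⟨-, i, j⟩
      omega

/-- The two over-points of a bigon are the ends of its over-edge. -/
theorem edge_eq_of_ne {x p q : D.X} (hpq : p ≠ q) (hp : p = x ∨ p = D.next x)
    (hq : q = x ∨ q = D.next x) : (p = x ∧ q = D.next x) ∨ (p = D.next x ∧ q = x) := by
  rcases hp with rfl | rfl <;> rcases hq with rfl | rfl
  · exact (hpq rfl).elim
  · exact Or.inl ⟨rfl, rfl⟩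
  · exact Or.inr ⟨rfl, rfl⟩
  · exact (hpq rfl).elim

/-- The two crossings have opposite signs and join the same components. With the base point at the
tail of the over-edge, their over-points come first, so neither is interlaced with anything. -/
theorem sameInvariants_r2 (a b : D.C) (s t : D.X × Side) (hab : a ≠ b)
    (ha : D.Corner a s t) (hb : D.Corner b s t) (hs : D.EdgeOver s.1) :
    SameInvariants D (D.erase {a, b}) := by
  classical
  obtain ⟨oa, ua⟩ := ha.of_edgeOver hs
  obtain ⟨ob, ub⟩ := hb.of_edgeOver hs
  have hne : D.overPt a ≠ D.overPt b := fun h => hab (overPt_injective h)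
  have hsign : D.sign a + D.sign b = 0 := by
    rcases ha.sign_eq hs with ⟨h1, h2⟩ | ⟨h1, h2⟩ <;>
      rcases hb.sign_eq hs with ⟨h3, h4⟩ | ⟨h3, h4⟩
    · exact (hne (h1.trans h3.symm)).elim
    · omega
    · omega
    · exact (hne (h1.trans h3.symm)).elim
  have hbase : ∃ e, D.overPt e = s.1 := hs.1
  refine ⟨Iff.rfl, Iff.rfl, ?_, fun hK => ⟨s.1, s.1, casson_erase _ _ ?_⟩⟩
  · let f : D.C → ℤ := fun c => if D.next.SameCycle (D.left c) (D.right c) then 0 else D.sign c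
    have hf : f a + f b = 0 := by
      have e : ∀ c, (D.overPt c = s.1 ∨ D.overPt c = D.next s.1) →
          (D.underPt c = t.1 ∨ D.underPt c = D.next t.1) →
          (D.next.SameCycle (D.left c) (D.right c) ↔ D.next.SameCycle s.1 t.1) := by
        intro c h1 h2
        have h1 := sameCycle_of_edge h1
        have h2 := sameCycle_of_edge h2
        rw [sameCycle_iff_over_under]
        exact ⟨fun h => h1.trans (h.trans h2.symm), fun h => h1.symm.trans (h.trans h2)⟩
      simp only [f]
      rw [if_congr (e a oa ua) rfl rfl, if_congr (e b ob ub) rfl rfl]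
      split_ifs
      · simp
      · exact hsign
    have h1 := sum_erase {a, b} (fun c => if c = a then 0 else if c = b then 0 else f c) (by
      rintro c (rfl | rfl) <;> simp)
    have h2 : ∀ c, f c = (if c = a then 0 else if c = b then 0 else f c) +
        ((if c = a then f a else 0) + (if c = b then f b else 0)) := by
      intro c
      by_cases h1 : c = a
      · have : a ≠ b := hab
        simp [h1, this]
      · by_cases h2 : c = b <;> simp [h1, h2, hab.symm]
    have h3 : ∑ c, f c = ∑ c, (if c = a then 0 else if c = b then 0 else f c) := by
      rw [Finset.sum_congr rfl fun c _ => h2 c, Finset.sum_add_distrib, Finset.sum_add_distrib,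
        Finset.sum_ite_eq', Finset.sum_ite_eq']
      simp [hf]
    refine Eq.trans (Finset.sum_congr rfl fun c _ => ?_) (h1.trans h3.symm)
    obtain ⟨c, hc⟩ := c
    have hc1 : c ≠ a := fun h => hc (Or.inl h)
    have hc2 : c ≠ b := fun h => hc (Or.inr h)
    exact (by rw [if_neg hc1, if_neg hc2] :
      (if c = a then 0 else if c = b then 0 else f c) = f c).symm
  · obtain ⟨e, he⟩ := hbase
    rintro _ (rfl | rfl) d
    · exact not_interlaced hK he (stepsFrom_edge_le oa) d
    · exact not_interlaced hK he (stepsFrom_edge_le ob) d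

/-! #### The third Reidemeister move -/

theorem relocate_overPt (f : Equiv.Perm D.X) (c : D.C) :
    (D.relocate f).overPt c = f (D.overPt c) := (apply_ite f _ _ _).symm

theorem relocate_underPt (f : Equiv.Perm D.X) (c : D.C) :
    (D.relocate f).underPt c = f (D.underPt c) := (apply_ite f _ _ _).symm

theorem swap_edge_eq [DecidableEq D.X] {x p q : D.X} (hpq : p ≠ q) (hp : p = x ∨ p = D.next x)
    (hq : q = x ∨ q = D.next x) : Equiv.swap x (D.next x) = Equiv.swap p q := by
  rcases edge_eq_of_ne hpq hp hq with ⟨rfl, rfl⟩ | ⟨rfl, rfl⟩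
  · rfl
  · exact Equiv.swap_comm _ _

/-- With the base point at the tail of the top edge, `a` and `b` are interlaced with nothing before
and after the move. The points of `c` only change places with neighbouring points of `a` and `b`,
which does not affect their order relative to the remaining crossings. -/
theorem sameInvariants_r3 (a b c : D.C) (s t u : D.X × Side)
    (hab : a ≠ b) (hac : a ≠ c) (hbc : b ≠ c)
    (ha : D.Corner a s t) (hb : D.Corner b s u) (hc : D.Corner c t u)
    (hs : D.EdgeOver s.1) (hu : D.EdgeUnder u.1) :
    SameInvariants D (D.relocate (D.swapEnds s.1 t.1 u.1)) := by
  classical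
  obtain ⟨oa, ua⟩ := ha.of_edgeOver hs
  obtain ⟨ob, ub⟩ := hb.of_edgeOver hs
  obtain ⟨oc, uc⟩ := hc.of_edgeUnder hu
  -- The top edge joins the over-points of `a` and `b`, the middle edge the under-point of `a` to
  -- the over-point of `c`, and the bottom edge the under-points of `b` and `c`.
  have hf : D.swapEnds s.1 t.1 u.1 = Equiv.swap (D.overPt a) (D.overPt b) *
      Equiv.swap (D.underPt a) (D.overPt c) * Equiv.swap (D.underPt b) (D.underPt c) := by
    rw [← swap_edge_eq (fun h => hab (overPt_injective h)) oa ob,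
      ← swap_edge_eq (overPt_ne_underPt c a).symm ua oc,
      ← swap_edge_eq (fun h => hbc (underPt_injective h)) ub uc]
    unfold swapEnds
    congr!
  have hcyc : ∀ p, D.next.SameCycle p (D.swapEnds s.1 t.1 u.1 p) := by
    intro p
    exact (sameCycle_swap_apply _ _).trans
      ((sameCycle_swap_apply _ _).trans (sameCycle_swap_apply _ _))
  generalize D.swapEnds s.1 t.1 u.1 = f at hf hcyc
  refine ⟨Iff.rfl, Iff.rfl, ?_, fun hK => ⟨s.1, s.1, ?_⟩⟩
  · refine Finset.sum_congr rfl fun d _ => if_congr ?_ rfl rfl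
    exact ⟨fun h => (hcyc _).trans (h.trans (hcyc _).symm),
      fun h => (hcyc _).symm.trans (h.trans (hcyc _))⟩
  · have hbs : ∀ z, D.next.SameCycle s.1 z := hK.sameCycle _
    have hinj := stepsFrom_injective hbs
    have hou := overPt_ne_underPt (D := D)
    have foa : f (D.overPt a) = D.overPt b := by
      rw [hf]
      simp [Equiv.swap_apply_def, hou, overPt_injective.eq_iff, hac]
    have fob : f (D.overPt b) = D.overPt a := by
      rw [hf]
      simp [Equiv.swap_apply_def, hou, overPt_injective.eq_iff, hbc]
    have foc : f (D.overPt c) = D.underPt a := by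
      rw [hf]
      simp [Equiv.swap_apply_def, hou, (hou _ _).symm]
    have fuc : f (D.underPt c) = D.underPt b := by
      rw [hf]
      simp [Equiv.swap_apply_def, (hou _ _).symm, underPt_injective.eq_iff, hab.symm]
    have fo : ∀ d, d ≠ a → d ≠ b → d ≠ c → f (D.overPt d) = D.overPt d := by
      intro d h1 h2 h3
      rw [hf]
      simp [Equiv.swap_apply_def, hou, overPt_injective.eq_iff, h1, h2, h3]
    have fu : ∀ d, d ≠ a → d ≠ b → d ≠ c → f (D.underPt d) = D.underPt d := by
      intro d h1 h2 h3
      rw [hf]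
      simp [Equiv.swap_apply_def, (hou _ _).symm, underPt_injective.eq_iff, h1, h2, h3]
    obtain ⟨e, he⟩ := hs.1
    -- The base point is still an over-point after the move, so `not_interlaced` applies to both
    -- diagrams.
    have hE : ∃ e, (D.relocate f).overPt e = s.1 := by
      rcases edge_eq_of_ne (fun h => hab (overPt_injective h)) oa ob with ⟨h, -⟩ | ⟨-, h⟩
      · exact ⟨b, by rw [relocate_overPt, fob, h]⟩
      · exact ⟨a, by rw [relocate_overPt, foa, h]⟩
    obtain ⟨e', he'⟩ := hE
    have hD1 : ∀ d, d = a ∨ d = b → ∀ d', ¬ D.Interlaced s.1 d d' ∧ ¬ D.Interlaced s.1 d' d := by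
      rintro d (rfl | rfl)
      · exact not_interlaced hK he (stepsFrom_edge_le oa)
      · exact not_interlaced hK he (stepsFrom_edge_le ob)
    have hE1 : ∀ d : D.C, d = a ∨ d = b → ∀ d' : D.C, ¬ (D.relocate f).Interlaced s.1 d d' ∧
        ¬ (D.relocate f).Interlaced s.1 d' d := by
      rintro d (rfl | rfl)
      · refine not_interlaced (D := D.relocate f) hK he' ?_
        rw [relocate_overPt, foa]
        exact stepsFrom_edge_le ob
      · refine not_interlaced (D := D.relocate f) hK he' ?_
        rw [relocate_overPt, fob]
        exact stepsFrom_edge_le oa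
    have hbase : ∀ d, D.underPt d ≠ s.1 := fun d h => hou e d (he.trans h.symm)
    have hbase' : D.overPt c ≠ s.1 := by
      intro h
      rcases edge_eq_of_ne (fun h => hab (overPt_injective h)) oa ob with ⟨h1, -⟩ | ⟨-, h1⟩
      · exact hac (overPt_injective (h1.trans h.symm))
      · exact hbc (overPt_injective (h1.trans h.symm))
    -- Neither end of this edge is the base point, so the two positions are consecutive without
    -- wrapping around, and no third point lies between them.
    have ht : D.next.stepsFrom s.1 (D.underPt a) + 1 = D.next.stepsFrom s.1 (D.overPt c) ∨
        D.next.stepsFrom s.1 (D.overPt c) + 1 = D.next.stepsFrom s.1 (D.underPt a) := by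
      rcases edge_eq_of_ne (hou c a).symm ua oc with ⟨h1, h2⟩ | ⟨h1, h2⟩
      · left
        rw [h1, h2, stepsFrom_apply hbs (h2 ▸ hbase')]
      · right
        rw [h1, h2, stepsFrom_apply hbs (h1 ▸ hbase a)]
    have hu' : D.next.stepsFrom s.1 (D.underPt b) + 1 = D.next.stepsFrom s.1 (D.underPt c) ∨
        D.next.stepsFrom s.1 (D.underPt c) + 1 = D.next.stepsFrom s.1 (D.underPt b) := by
      rcases edge_eq_of_ne (fun h => hbc (underPt_injective h)) ub uc with ⟨h1, h2⟩ | ⟨h1, h2⟩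
      · left
        rw [h1, h2, stepsFrom_apply hbs (h2 ▸ hbase c)]
      · right
        rw [h1, h2, stepsFrom_apply hbs (h1 ▸ hbase b)]
    have hI : ∀ d d' : D.C, (D.relocate f).Interlaced s.1 d d' ↔
        D.next.stepsFrom s.1 (f (D.underPt d)) < D.next.stepsFrom s.1 (f (D.overPt d')) ∧
        D.next.stepsFrom s.1 (f (D.overPt d')) < D.next.stepsFrom s.1 (f (D.overPt d)) ∧
        D.next.stepsFrom s.1 (f (D.overPt d)) < D.next.stepsFrom s.1 (f (D.underPt d')) := by
      intro d d'
      unfold Interlaced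
      rw [relocate_overPt, relocate_overPt, relocate_underPt, relocate_underPt]
      rfl
    have hno : ∀ d, d ≠ c → ∀ d', D.next.stepsFrom s.1 (D.overPt d) ≠
        D.next.stepsFrom s.1 (D.overPt c) ∧ D.next.stepsFrom s.1 (D.overPt d) ≠
        D.next.stepsFrom s.1 (D.underPt d') := fun d hd d' =>
      ⟨fun h => hd (overPt_injective (hinj h)), fun h => hou _ _ (hinj h)⟩
    have hnu : ∀ d d', d ≠ d' → D.next.stepsFrom s.1 (D.underPt d) ≠
        D.next.stepsFrom s.1 (D.underPt d') ∧ D.next.stepsFrom s.1 (D.underPt d) ≠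
        D.next.stepsFrom s.1 (D.overPt c) := fun d d' hd =>
      ⟨fun h => hd (underPt_injective (hinj h)), fun h => hou _ _ (hinj h).symm⟩
    have key : ∀ d d' : D.C, (D.relocate f).Interlaced s.1 d d' ↔ D.Interlaced s.1 d d' := by
      intro d d'
      by_cases hd : d = a ∨ d = b
      · exact iff_of_false (hE1 d hd d').1 (hD1 d hd d').1
      by_cases hd' : d' = a ∨ d' = b
      · exact iff_of_false (hE1 d' hd' d).2 (hD1 d' hd' d).2
      push Not at hd hd'
      rw [hI]
      unfold Interlaced
      by_cases h1 : d = c <;> by_cases h2 : d' = c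
      · subst h1 h2
        omega
      · subst h1
        rw [foc, fuc, fo d' hd'.1 hd'.2 h2, fu d' hd'.1 hd'.2 h2]
        have := hno d' h2 a
        have := hno d' h2 b
        have := hno d' h2 d
        have := hnu d' a hd'.1
        omega
      · subst h2
        rw [foc, fuc, fo d hd.1 hd.2 h1, fu d hd.1 hd.2 h1]
        have := hno d h1 a
        have := hno d h1 b
        have := hno d h1 d'
        have := hnu d a hd.1
        omega
      · rw [fo d hd.1 hd.2 h1, fu d hd.1 hd.2 h1, fo d' hd'.1 hd'.2 h2, fu d' hd'.1 hd'.2 h2]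
    exact Finset.sum_congr rfl fun d _ => Finset.sum_congr rfl fun d' _ =>
      if_congr (key d d') rfl rfl

theorem Move.sameInvariants (h : Move D E) : SameInvariants D E := by
  cases h with
  | iso e => exact e.sameInvariants
  | mark x => exact sameInvariants_addMark D x
  | r1 c s h => exact sameInvariants_r1 c s h
  | r2 a b s t hab ha hb hs ht => exact sameInvariants_r2 a b s t hab ha hb hs
  | r3 a b c s t u hab hac hbc ha hb hc hs hu =>
    exact sameInvariants_r3 a b c s t u hab hac hbc ha hb hc hs hu

/-! ### The coefficients of the Conway polynomial -/

variable (D) in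
/-- The polynomial `p` has the coefficients of degree at most two that are determined by the
invariants of low degree of a planar diagram. -/
structure LowCoeffs (p : ℤ[X]) : Prop where
  planar : D.Planar
  coeff_zero : D.IsKnot → p.coeff 0 = 1
  coeff_zero' : ¬ D.IsKnot → p.coeff 0 = 0
  coeff_one : D.HasTwoComponents → 2 * p.coeff 1 = D.totalLinking
  coeff_two : D.IsKnot → ∀ b, p.coeff 2 = D.casson b

/-- `SameInvariants` compares the Gauss sums at one convenient pair of base points only; planarity
of both diagrams extends this to all base points. -/
theorem LowCoeffs.congr (h : SameInvariants D E) (hD : D.Planar) (hE : E.Planar) (p : ℤ[X]) :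
    LowCoeffs D p ↔ LowCoeffs E p := by
  constructor
  · intro hp
    refine ⟨hE, fun k => hp.coeff_zero (h.isKnot.1 k), fun k => hp.coeff_zero' (mt h.isKnot.2 k),
      fun k => ?_, fun k b => ?_⟩
    · rw [h.totalLinking, hp.coeff_one (h.hasTwoComponents.1 k)]
    · obtain ⟨b₁, b₂, hb⟩ := h.casson (h.isKnot.1 k)
      rw [hp.coeff_two (h.isKnot.1 k) b₁, ← hb, hE.casson_eq k b₂ b]
  · intro hp
    refine ⟨hD, fun k => hp.coeff_zero (h.isKnot.2 k), fun k => hp.coeff_zero' (mt h.isKnot.1 k),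
      fun k => ?_, fun k b => ?_⟩
    · rw [← h.totalLinking, hp.coeff_one (h.hasTwoComponents.2 k)]
    · obtain ⟨b₁, b₂, hb⟩ := h.casson k
      rw [hp.coeff_two (h.isKnot.2 k) b₂, hb, hD.casson_eq k b₁ b]

theorem Equivalent.lowCoeffs_iff (h : Equivalent D E) (p : ℤ[X]) :
    LowCoeffs D p ↔ LowCoeffs E p := by
  induction h with
  | rel D E h => exact LowCoeffs.congr h.2.2.sameInvariants h.1 h.2.1 p
  | refl D => exact Iff.rfl
  | symm D E _ ih => exact ih.symm
  | trans D E F _ _ ih₁ ih₂ => exact ih₁.trans ih₂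

end LinkDiagram

namespace LinkDiagram

open Equiv.Perm

variable {D E : LinkDiagram}

/-! ### Planarity of elementary constructions -/

/-- An isomorphism of the underlying oriented diagrams, without the signs of the crossings. -/
structure ShapeIso (D E : LinkDiagram) where
  onX : D.X ≃ E.X
  onC : D.C ≃ E.C
  next_comm : ∀ x, onX (D.next x) = E.next (onX x)
  left_comm : ∀ c, onX (D.left c) = E.left (onC c)
  right_comm : ∀ c, onX (D.right c) = E.right (onC c)

/-- An isomorphism forgets to an isomorphism of shapes. -/
def Iso.toShapeIso (e : Iso D E) : ShapeIso D E :=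
  ⟨e.onX, e.onC, e.next_comm, e.left_comm, e.right_comm⟩

namespace ShapeIso

/-- The inverse of an isomorphism of shapes. -/
def symm (e : ShapeIso D E) : ShapeIso E D where
  onX := e.onX.symm
  onC := e.onC.symm
  next_comm x := by rw [Equiv.symm_apply_eq, e.next_comm, Equiv.apply_symm_apply]
  left_comm c := by rw [Equiv.symm_apply_eq, e.left_comm, Equiv.apply_symm_apply]
  right_comm c := by rw [Equiv.symm_apply_eq, e.right_comm, Equiv.apply_symm_apply]

theorem next_symm_comm (e : ShapeIso D E) (x : D.X) :
    e.onX (D.next.symm x) = E.next.symm (e.onX x) := by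
  rw [Equiv.eq_symm_apply, ← e.next_comm, Equiv.apply_symm_apply]

theorem isMark (e : ShapeIso D E) {x : D.X} (hx : D.IsMark x) : E.IsMark (e.onX x) := by
  intro c
  obtain ⟨c, rfl⟩ := e.onC.surjective c
  rw [← e.left_comm, ← e.right_comm]
  exact ⟨fun h => (hx c).1 (e.onX.injective h), fun h => (hx c).2 (e.onX.injective h)⟩

/-- The induced map on the faces. -/
def face (e : ShapeIso D E) : D.Face → E.Face :=
  Quot.lift (fun s => E.faceOf (e.onX s.1, s.2)) (by
    have key : ∀ c s t, D.CornerAux c s t →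
        E.faceOf (e.onX s.1, s.2) = E.faceOf (e.onX t.1, t.2) := by
      rintro c s t (_ | _ | _ | _) <;> simp only [e.next_symm_comm, e.left_comm, e.right_comm]
      · exact E.faceOf_bottom _
      · exact E.faceOf_east _
      · exact E.faceOf_top _
      · exact E.faceOf_west _
    rintro ⟨y, σ⟩ ⟨z, τ⟩ (⟨c, h | h⟩ | ⟨w, hx, h1, h2, h3⟩)
    · exact key _ _ _ h
    · exact (key _ _ _ h).symm
    · simp only at h1 h2 h3
      subst h1 h2 h3
      simp only [e.next_symm_comm]
      exact E.faceOf_mark (e.isMark hx) _)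

/-- The induced map on the pieces. -/
def piece (e : ShapeIso D E) : D.Piece → E.Piece :=
  Quot.lift (fun x => E.pieceOf (e.onX x)) (by
    rintro x y (rfl | ⟨c, rfl, rfl⟩)
    · rw [e.next_comm, pieceOf_next]
    · rw [e.left_comm, e.right_comm, pieceOf_left])

theorem card_face (e : ShapeIso D E) : Nat.card D.Face = Nat.card E.Face :=
  Nat.card_congr ⟨e.face, e.symm.face,
    by rintro ⟨x, σ⟩; exact congrArg D.faceOf (Prod.ext (e.onX.symm_apply_apply x) rfl),
    by rintro ⟨x, σ⟩; exact congrArg E.faceOf (Prod.ext (e.onX.apply_symm_apply x) rfl)⟩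

theorem card_piece (e : ShapeIso D E) : Nat.card D.Piece = Nat.card E.Piece :=
  Nat.card_congr ⟨e.piece, e.symm.piece,
    by rintro ⟨x⟩; exact congrArg D.pieceOf (e.onX.symm_apply_apply x),
    by rintro ⟨x⟩; exact congrArg E.pieceOf (e.onX.apply_symm_apply x)⟩

theorem planar_iff (e : ShapeIso D E) : D.Planar ↔ E.Planar := by
  unfold Planar
  rw [e.card_face, e.card_piece, Nat.card_congr e.onC]

end ShapeIso

/-- The signs do not matter for the shape. -/
noncomputable def shapeIsoWithSign (D : LinkDiagram) (c : D.C) (b : Bool) :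
    ShapeIso D (D.withSign c b) :=
  ⟨Equiv.refl _, Equiv.refl _, fun _ => rfl, fun _ => rfl, fun _ => rfl⟩

theorem Planar.withSign (hD : D.Planar) (c : D.C) (b : Bool) : (D.withSign c b).Planar :=
  (shapeIsoWithSign D c b).planar_iff.1 hD

section Mark

variable (D) (x : D.X)

theorem addMark_next_symm (z : D.X) :
    D.forgetMark x ((D.addMark x).next.symm (D.oldPoint x z)) = D.next.symm z := by
  by_cases hz : z = D.next x
  · subst hz
    rw [← addMark_next_new, Equiv.symm_apply_apply, Equiv.symm_apply_apply, forgetMark_new]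
  · obtain ⟨w, rfl⟩ := D.next.surjective z
    have hw : w ≠ x := fun h => hz (by rw [h])
    rw [← addMark_next_of_ne D x hw, Equiv.symm_apply_apply, Equiv.symm_apply_apply,
      forgetMark_old]

theorem isMark_newPoint : (D.addMark x).IsMark (D.newPoint x) := fun _ =>
  ⟨Option.some_ne_none _, Option.some_ne_none _⟩

theorem isMark_oldPoint {z : D.X} : (D.addMark x).IsMark (D.oldPoint x z) ↔ D.IsMark z :=
  forall_congr' fun _ => and_congr
    (not_congr (D.oldPoint_injective x).eq_iff) (not_congr (D.oldPoint_injective x).eq_iff)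

theorem addMark_left (c : (D.addMark x).C) : (D.addMark x).left c = D.oldPoint x (D.left c) := rfl

theorem addMark_right (c : (D.addMark x).C) :
    (D.addMark x).right c = D.oldPoint x (D.right c) := rfl

theorem faceOf_forgetMark (z : (D.addMark x).X) (σ : Side) :
    (D.addMark x).faceOf (D.oldPoint x (D.forgetMark x z), σ) = (D.addMark x).faceOf (z, σ) := by
  rcases addMark_cases D x z with rfl | ⟨w, rfl⟩
  · rw [forgetMark_new, ← faceOf_mark _ (isMark_newPoint D x), ← addMark_next_self,
      Equiv.symm_apply_apply]
  · rw [forgetMark_old]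

/-- Forgetting a mark, on faces. -/
noncomputable def forgetMarkFace : (D.addMark x).Face → D.Face :=
  Quot.lift (fun s => D.faceOf (D.forgetMark x s.1, s.2)) (by
    have key : ∀ c s t, (D.addMark x).CornerAux c s t →
        D.faceOf (D.forgetMark x s.1, s.2) = D.faceOf (D.forgetMark x t.1, t.2) := by
      rintro c s t (_ | _ | _ | _) <;>
        simp only [addMark_left, addMark_right, addMark_next_symm, forgetMark_old]
      · exact D.faceOf_bottom _
      · exact D.faceOf_east _
      · exact D.faceOf_top _
      · exact D.faceOf_west _
    rintro ⟨y, σ⟩ ⟨z, τ⟩ (⟨c, h | h⟩ | ⟨w, hw, h1, h2, h3⟩)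
    · exact key _ _ _ h
    · exact (key _ _ _ h).symm
    · simp only at h1 h2 h3
      subst h1 h2 h3
      rcases addMark_cases D x z with rfl | ⟨w, rfl⟩
      · rw [← addMark_next_self, Equiv.symm_apply_apply, addMark_next_self, forgetMark_new,
          forgetMark_old]
      · rw [addMark_next_symm, forgetMark_old]
        exact D.faceOf_mark ((isMark_oldPoint D x).1 hw) _)

/-- The faces of a diagram as faces of the diagram with one more mark. -/
noncomputable def oldFace : D.Face → (D.addMark x).Face :=
  Quot.lift (fun s => (D.addMark x).faceOf (D.oldPoint x s.1, s.2)) (by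
    have hs : ∀ z σ, (D.addMark x).faceOf (D.oldPoint x (D.next.symm z), σ) =
        (D.addMark x).faceOf ((D.addMark x).next.symm (D.oldPoint x z), σ) := by
      intro z σ
      rw [← addMark_next_symm D x z, faceOf_forgetMark]
    have key : ∀ c s t, D.CornerAux c s t → (D.addMark x).faceOf (D.oldPoint x s.1, s.2) =
        (D.addMark x).faceOf (D.oldPoint x t.1, t.2) := by
      rintro c s t (_ | _ | _ | _) <;> simp only [hs]
      · exact (D.addMark x).faceOf_bottom _
      · exact (D.addMark x).faceOf_east _
      · exact (D.addMark x).faceOf_top _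
      · exact (D.addMark x).faceOf_west _
    rintro ⟨y, σ⟩ ⟨z, τ⟩ (⟨c, h | h⟩ | ⟨w, hw, h1, h2, h3⟩)
    · exact key _ _ _ h
    · exact (key _ _ _ h).symm
    · simp only at h1 h2 h3
      subst h1 h2 h3
      simp only [hs]
      exact (D.addMark x).faceOf_mark ((isMark_oldPoint D x).2 hw) _)

theorem card_face_addMark : Nat.card (D.addMark x).Face = Nat.card D.Face :=
  Nat.card_congr ⟨D.forgetMarkFace x, D.oldFace x,
    by rintro ⟨z, σ⟩; exact faceOf_forgetMark D x z σ,
    by rintro ⟨z, σ⟩; rfl⟩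

theorem pieceOf_forgetMark (z : (D.addMark x).X) :
    (D.addMark x).pieceOf (D.oldPoint x (D.forgetMark x z)) = (D.addMark x).pieceOf z := by
  rcases addMark_cases D x z with rfl | ⟨w, rfl⟩
  · rw [forgetMark_new, ← addMark_next_self, pieceOf_next]
  · rw [forgetMark_old]

/-- Forgetting a mark, on pieces. -/
noncomputable def forgetMarkPiece : (D.addMark x).Piece → D.Piece :=
  Quot.lift (fun z => D.pieceOf (D.forgetMark x z)) (by
    rintro y z (rfl | ⟨c, rfl, rfl⟩)
    · rcases addMark_cases D x y with rfl | ⟨w, rfl⟩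
      · rw [addMark_next_new, forgetMark_new, forgetMark_old, pieceOf_next]
      · by_cases hw : w = x
        · rw [hw, addMark_next_self, forgetMark_new, forgetMark_old]
        · rw [addMark_next_of_ne D x hw, forgetMark_old, forgetMark_old, pieceOf_next]
    · rw [addMark_left, addMark_right, forgetMark_old, forgetMark_old]
      exact D.pieceOf_left c)

/-- The pieces of a diagram as pieces of the diagram with one more mark. -/
noncomputable def oldPiece : D.Piece → (D.addMark x).Piece :=
  Quot.lift (fun z => (D.addMark x).pieceOf (D.oldPoint x z)) (by
    rintro y z (rfl | ⟨c, rfl, rfl⟩)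
    · have h := pieceOf_forgetMark D x ((D.addMark x).next.symm (D.oldPoint x (D.next y)))
      rwa [addMark_next_symm, Equiv.symm_apply_apply, pieceOf_symm] at h
    · exact (D.addMark x).pieceOf_left c)

theorem card_piece_addMark : Nat.card (D.addMark x).Piece = Nat.card D.Piece :=
  Nat.card_congr ⟨D.forgetMarkPiece x, D.oldPiece x,
    by rintro ⟨z⟩; exact pieceOf_forgetMark D x z,
    by rintro ⟨z⟩; rfl⟩

theorem planar_addMark_iff : (D.addMark x).Planar ↔ D.Planar := by
  unfold Planar
  rw [card_face_addMark, card_piece_addMark]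
  exact Iff.rfl

end Mark

/-- Each circle is a piece on its own sphere and has two faces. -/
theorem planar_circles (n : ℕ) : (circles n).Planar := by
  have h1 : Nat.card (circles n).Face = Nat.card (Fin n × Bool) := by
    refine Nat.card_congr ⟨Quot.lift (fun s => (s.1, match s.2 with | .L => true | .R => false)) ?_,
      fun s => (circles n).faceOf (s.1, if s.2 then .L else .R), ?_, ?_⟩
    · rintro ⟨y, σ⟩ ⟨z, τ⟩ (⟨c, -⟩ | ⟨w, hw, h1, h2, h3⟩)
      · exact c.elim
      · simp only at h1 h2 h3
        subst h1 h2 h3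
        rfl
    · rintro ⟨x, (_ | _)⟩ <;> rfl
    · rintro ⟨x, (_ | _)⟩ <;> rfl
  have h2 : Nat.card (circles n).Piece = Nat.card (Fin n) := by
    refine Nat.card_congr ⟨Quot.lift id ?_, fun x => (circles n).pieceOf x, ?_, ?_⟩
    · rintro y z (rfl | ⟨c, -⟩)
      · rfl
      · exact c.elim
    · rintro ⟨x⟩; rfl
    · intro x; rfl
  have h3 : Nat.card (circles n).C = 0 := by
    change Nat.card Empty = 0
    simp
  unfold Planar
  rw [h1, h2, h3]
  simp
  omega

/-! ### Uniqueness -/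

theorem circles_sameCycle {n : ℕ} {x y : Fin n} (h : (circles n).next.SameCycle x y) : x = y := by
  obtain ⟨k, hk⟩ := h
  have : ((1 : Equiv.Perm (Fin n)) ^ k) x = y := hk
  simpa using this

instance (n : ℕ) : IsEmpty (circles n).C := inferInstanceAs (IsEmpty Empty)

theorem lowCoeffs_unknot : LowCoeffs (circles 1) 1 where
  planar := planar_circles 1
  coeff_zero _ := by simp
  coeff_zero' h := (h ⟨(0 : Fin 1), fun y => by
    rw [show y = (0 : Fin 1) from Subsingleton.elim (α := Fin 1) _ _]
    exact SameCycle.refl _ _⟩).elim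
  coeff_one := by
    rintro ⟨x, y, hxy, -⟩
    refine (hxy ?_).elim
    rw [show x = y from Subsingleton.elim (α := Fin 1) _ _]
  coeff_two _ b := by
    simp [casson, coeff_one]

theorem lowCoeffs_unlink (n : ℕ) (hn : 2 ≤ n) : LowCoeffs (circles n) 0 where
  planar := planar_circles n
  coeff_zero := by
    rintro ⟨x, hx⟩
    have h1 := circles_sameCycle (hx (⟨0, by omega⟩ : Fin n))
    have h2 := circles_sameCycle (hx (⟨1, by omega⟩ : Fin n))
    have := h1.symm.trans h2
    simp at this
  coeff_zero' _ := by simp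
  coeff_one _ := by simp [totalLinking]
  coeff_two := by
    rintro ⟨x, hx⟩
    have h1 := circles_sameCycle (hx (⟨0, by omega⟩ : Fin n))
    have h2 := circles_sameCycle (hx (⟨1, by omega⟩ : Fin n))
    have := h1.symm.trans h2
    simp at this

/-- The coefficients of degree at most two on the two sides of the skein relation. -/
theorem LowCoeffs.skein (hD : D.Planar) (c : D.C) {p q p₀ : ℤ[X]} (h : p = q + Polynomial.X * p₀)
    (h₀ : LowCoeffs (D.smooth c) p₀) :
    LowCoeffs (D.withSign c true) p ↔ LowCoeffs (D.withSign c false) q := by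
  classical
  have e0 : p.coeff 0 = q.coeff 0 := by simp [h]
  have e1 : p.coeff 1 = q.coeff 1 + p₀.coeff 0 := by rw [h, coeff_add, coeff_X_mul p₀ 0]
  have e2 : p.coeff 2 = q.coeff 2 + p₀.coeff 1 := by rw [h, coeff_add, coeff_X_mul p₀ 1]
  -- The constant term of `p₀` is 1 or 0 according to whether the smoothing is a knot, that is,
  -- whether `c` joins the two components.
  have hlk : D.HasTwoComponents → (D.withSign c true).totalLinking =
      (D.withSign c false).totalLinking + 2 * p₀.coeff 0 := by
    intro h2
    rw [totalLinking_withSign]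
    by_cases hs : D.next.SameCycle (D.left c) (D.right c)
    · rw [if_pos hs, h₀.coeff_zero' (by rw [isKnot_smooth_iff h2]; simpa using hs)]
      simp
    · rw [if_neg hs, h₀.coeff_zero ((isKnot_smooth_iff h2 c).2 hs)]
      simp
  -- The jump of the Gauss sum is half the total linking of the smoothing, hence the coefficient of
  -- z in `p₀`. The formula holds at `D.left c` and is carried to `b` by planarity.
  have hca : D.IsKnot → ∀ b : D.X, (D.withSign c true).casson b =
      (D.withSign c false).casson b + p₀.coeff 1 := by
    intro hK b
    have i1 := h₀.coeff_one (hasTwoComponents_smooth hK c)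
    rw [totalLinking_smooth hD hK c] at i1
    have i2 := casson_withSign hK c
    rw [(hD.withSign c true).casson_eq hK b (D.left c),
      (hD.withSign c false).casson_eq hK b (D.left c), i2]
    omega
  constructor
  · intro hp
    refine ⟨hD.withSign c false, fun k => ?_, fun k => ?_, fun k => ?_, fun k b => ?_⟩
    · rw [← e0]; exact hp.coeff_zero k
    · rw [← e0]; exact hp.coeff_zero' k
    · have i1 := hp.coeff_one k
      have i2 := hlk k
      omega
    · have i1 := hp.coeff_two k b
      have i2 := hca k b
      omega
  · intro hp
    refine ⟨hD.withSign c true, fun k => ?_, fun k => ?_, fun k => ?_, fun k b => ?_⟩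
    · rw [e0]; exact hp.coeff_zero k
    · rw [e0]; exact hp.coeff_zero' k
    · have i1 := hp.coeff_one k
      have i2 := hlk k
      omega
    · have i1 := hp.coeff_two k b
      have i2 := hca k b
      omega

/-- Every rule of the recursion preserves the intrinsic description of the low coefficients, so any
two derivations for a knot agree in degree two. -/
theorem HasConway.lowCoeffs {p : ℤ[X]} (h : HasConway D p) : LowCoeffs D p := by
  induction h with
  | unknot => exact lowCoeffs_unknot
  | unlink n hn => exact lowCoeffs_unlink n hn
  | invariant h _ ih => exact (h.lowCoeffs_iff _).1 ih
  | skein_pos D c hD _ _ ih₁ ih₀ => exact (LowCoeffs.skein hD c rfl ih₀).2 ih₁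
  | skein_neg D c hD _ _ ih₁ ih₀ =>
    exact (LowCoeffs.skein hD c (by ring) ih₀).1 ih₁

theorem IsKnot.coeff_two_eq (hD : D.IsKnot) {p q : ℤ[X]} (hp : HasConway D p)
    (hq : HasConway D q) : p.coeff 2 = q.coeff 2 := by
  obtain ⟨b, hb⟩ := id hD
  rw [hp.lowCoeffs.coeff_two hD b, hq.lowCoeffs.coeff_two hD b]

end LinkDiagram

namespace LinkDiagram

variable {D E F : LinkDiagram}

/-! ### Closures of two-strand braids -/

/-- The closure of a braid with two strands, which has `M + 1` levels. Each of the first `n` levels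
is a crossing; each of the others consists of two marks. -/
def braid (M n : ℕ) (b : Bool) : LinkDiagram where
  X := Fin (M + 1) × Bool
  C := {j : Fin (M + 1) // j.val < n}
  finite_X := inferInstance
  next := Equiv.prodCongr (finRotate (M + 1)) (Equiv.refl Bool) *
    Function.Involutive.toPerm (fun x : Fin (M + 1) × Bool => (x.1, xor x.2 (decide (x.1.val < n))))
      (fun x => by simp)
  left j := (j.1, true)
  right j := (j.1, false)
  injective_points := by
    rintro (a | a) (b | b) h <;> simp_all [Subtype.ext_iff]
  positive _ := b

section Braid

variable (M n : ℕ) (b : Bool)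

/-- The points of the closure of a braid. -/
def braidPt (j : Fin (M + 1)) (β : Bool) : (braid M n b).X := (j, β)

theorem braid_next (j : Fin (M + 1)) (β : Bool) : (braid M n b).next (braidPt M n b j β) =
    braidPt M n b (j + 1) (xor β (decide (j.val < n))) := by
  change (finRotate (M + 1) j, _) = _
  rw [finRotate_apply]
  rfl

theorem braid_next_symm (j : Fin (M + 1)) (β : Bool) :
    (braid M n b).next.symm (braidPt M n b j β) =
      braidPt M n b (j - 1) (xor β (decide ((j - 1).val < n))) := by
  rw [Equiv.symm_apply_eq, braid_next, sub_add_cancel, Bool.xor_assoc, Bool.xor_self,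
    Bool.xor_false]

end Braid

/-! #### Planarity -/

/-- The faces are the M + 1 regions between consecutive crossings, together with the two regions
bordered by only one side of the braid. The diagram is connected, and M + 3 = (M + 1) + 2. -/
theorem planar_braid_full (M : ℕ) (b : Bool) : (braid M (M + 1) b).Planar := by
  have hnext : ∀ j β, (braid M (M + 1) b).next (braidPt M (M + 1) b j β) =
      braidPt M (M + 1) b (j + 1) (!β) := by
    intro j β
    rw [braid_next, decide_eq_true j.isLt, Bool.xor_true]
  have hsymm : ∀ j β, (braid M (M + 1) b).next.symm (braidPt M (M + 1) b j β) =
      braidPt M (M + 1) b (j - 1) (!β) := by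
    intro j β
    rw [Equiv.symm_apply_eq, hnext]
    simp
  have hmark : ∀ x, ¬ (braid M (M + 1) b).IsMark x := by
    rintro ⟨j, β⟩ h
    cases β
    · exact (h ⟨j, j.isLt⟩).2 rfl
    · exact (h ⟨j, j.isLt⟩).1 rfl
  let f : (braid M (M + 1) b).X × Side → Fin (M + 1) ⊕ Bool := fun s =>
    match s with
    | ((j, true), .L) => Sum.inl j
    | ((j, false), .R) => Sum.inl j
    | ((_, true), .R) => Sum.inr true
    | ((_, false), .L) => Sum.inr false
  have key : ∀ c s t, (braid M (M + 1) b).CornerAux c s t → f s = f t := by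
    have hl : ∀ c, (braid M (M + 1) b).left c = braidPt M (M + 1) b c.1 true := fun _ => rfl
    have hr : ∀ c, (braid M (M + 1) b).right c = braidPt M (M + 1) b c.1 false := fun _ => rfl
    rintro c s t (_ | _ | _ | _) <;> simp only [hl, hr, hsymm] <;> rfl
  have hf : ∀ s t, (braid M (M + 1) b).FaceAdj s t → f s = f t := by
    rintro s t (⟨c, h | h⟩ | ⟨w, hw, -⟩)
    · exact key _ _ _ h
    · exact (key _ _ _ h).symm
    · exact (hmark w hw).elim
  have hstep : ∀ {α : Type} (g : Fin (M + 1) → α), (∀ j, g (j - 1) = g j) → ∀ j, g 0 = g j := by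
    intro α g hg j
    induction j using Fin.induction with
    | zero => rfl
    | succ i ih =>
      rw [ih, ← hg i.succ]
      congr 1
      rw [eq_sub_iff_add_eq, Fin.coeSucc_eq_succ]
  have h1 : Nat.card (braid M (M + 1) b).Face = Nat.card (Fin (M + 1) ⊕ Bool) := by
    refine Nat.card_congr ⟨Quot.lift f hf, Sum.elim
      (fun j => (braid M (M + 1) b).faceOf (braidPt M (M + 1) b j true, .L))
      (fun β => (braid M (M + 1) b).faceOf (braidPt M (M + 1) b 0 β, if β then .R else .L)), ?_, ?_⟩
    · rintro ⟨⟨⟨j, (_ | _)⟩, (_ | _)⟩⟩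
      · refine hstep (fun j => (braid M (M + 1) b).faceOf (braidPt M (M + 1) b j false, .L)) ?_ j
        intro j
        have := (braid M (M + 1) b).faceOf_west ⟨j, j.isLt⟩
        exact (congrArg (fun x => (braid M (M + 1) b).faceOf (x, .L)) (hsymm j true)).symm.trans
          this.symm
      · exact (braid M (M + 1) b).faceOf_top ⟨j, j.isLt⟩
      · rfl
      · refine hstep (fun j => (braid M (M + 1) b).faceOf (braidPt M (M + 1) b j true, .R)) ?_ j
        intro j
        have := (braid M (M + 1) b).faceOf_east ⟨j, j.isLt⟩
        exact (congrArg (fun x => (braid M (M + 1) b).faceOf (x, .R)) (hsymm j false)).symm.trans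
          this
    · rintro (j | (_ | _)) <;> rfl
  have h2 : Nat.card (braid M (M + 1) b).Piece = 1 := by
    have hp : ∀ j β, (braid M (M + 1) b).pieceOf (braidPt M (M + 1) b j β) =
        (braid M (M + 1) b).pieceOf (braidPt M (M + 1) b j true) := by
      rintro j (_ | _)
      · exact ((braid M (M + 1) b).pieceOf_left ⟨j, j.isLt⟩).symm
      · rfl
    rw [Nat.card_eq_one_iff_unique]
    refine ⟨⟨?_⟩, ⟨(braid M (M + 1) b).pieceOf (braidPt M (M + 1) b 0 true)⟩⟩
    have hq : ∀ z, (braid M (M + 1) b).pieceOf (braidPt M (M + 1) b 0 true) = z := by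
      rintro ⟨⟨j, β⟩⟩
      refine Eq.trans ?_ (hp j β).symm
      refine hstep (fun j => (braid M (M + 1) b).pieceOf (braidPt M (M + 1) b j true)) ?_ j
      intro j
      have := (braid M (M + 1) b).pieceOf_symm (braidPt M (M + 1) b j false)
      rw [hsymm, hp j false] at this
      exact this
    intro z w
    rw [← hq z, hq w]
  have h3 : Nat.card (braid M (M + 1) b).C = M + 1 := by
    exact (Nat.card_congr (Equiv.subtypeUnivEquiv fun j => j.isLt)).trans (Nat.card_fin (M + 1))
  unfold Planar
  rw [h1, h2, h3]
  simp

/-! #### Marks, moves and smoothings of braids -/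

/-- Two circles. -/
def braidZeroIso (b : Bool) : Iso (circles 2) (braid 0 0 b) where
  onX := finTwoEquiv.trans (Equiv.uniqueProd Bool (Fin 1)).symm
  onC := ⟨Empty.elim, fun c => absurd c.2 (Nat.not_lt_zero _), fun c => c.elim,
    fun c => absurd c.2 (Nat.not_lt_zero _)⟩
  next_comm := by
    intro x
    have : ∀ x : Fin 2, (finTwoEquiv.trans (Equiv.uniqueProd Bool (Fin 1)).symm) x =
      (braid 0 0 b).next ((finTwoEquiv.trans (Equiv.uniqueProd Bool (Fin 1)).symm) x) := by
      intro x
      fin_cases x <;> rfl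
    exact this x
  left_comm c := c.elim
  right_comm c := c.elim
  positive_comm c := c.elim

/-- The points of a braid with two more points as the points of a braid with one more level. -/
def insertLevel (M : ℕ) (β : Bool) : Option (Option (Fin (M + 1) × Bool)) → Fin (M + 2) × Bool
  | none => (Fin.last (M + 1), β)
  | some none => (Fin.last (M + 1), !β)
  | some (some z) => (z.1.castSucc, z.2)

theorem insertLevel_bijective (M : ℕ) (β : Bool) : Function.Bijective (insertLevel M β) := by
  rw [Fintype.bijective_iff_injective_and_card]
  constructor
  · rintro (_ | _ | ⟨i, γ⟩) (_ | _ | ⟨j, δ⟩) h <;>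
      simp only [insertLevel, Prod.mk.injEq] at h
    · rfl
    · simp at h
    · exact ((Fin.castSucc_ne_last j) h.1.symm).elim
    · simp at h
    · rfl
    · exact ((Fin.castSucc_ne_last j) h.1.symm).elim
    · exact ((Fin.castSucc_ne_last i) h.1).elim
    · exact ((Fin.castSucc_ne_last i) h.1).elim
    · rw [Fin.castSucc_injective _ h.1, h.2]
  · simp
    ring

theorem braidPt_injective (M n : ℕ) (b : Bool) {i j : Fin (M + 1)} {β γ : Bool}
    (h : braidPt M n b i β = braidPt M n b j γ) : i = j ∧ β = γ := Prod.mk.inj h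

/-- Adding a mark to each of the outermost strands of a braid. -/
theorem exists_iso_braid_succ {M n : ℕ} (b : Bool) (hn : n ≤ M + 1) :
    ∃ x y, Nonempty (Iso (((braid M n b).addMark x).addMark y) (braid (M + 1) n b)) := by
  set x := braidPt M n b (Fin.last M) true with hx
  set y := (braid M n b).oldPoint x (braidPt M n b (Fin.last M) false) with hy
  have hxy : y ≠ (braid M n b).oldPoint x x := fun h => by
    have := braidPt_injective M n b ((braid M n b).oldPoint_injective x h)
    simp at this
  have hny : (braid M n b).newPoint x ≠ y := fun h => Option.some_ne_none _ h.symm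
  refine ⟨x, y, ?_⟩
  -- The mark behind `y`, on the strand `false`, arrives on the strand `true` of the new level
  -- exactly when the old last level `M` is a crossing.
  let φ : (((braid M n b).addMark x).addMark y).X ≃ (braid (M + 1) n b).X :=
    Equiv.ofBijective (insertLevel M (decide (M < n))) (insertLevel_bijective _ _)
  have φ0 : φ (((braid M n b).addMark x).newPoint y) =
      braidPt (M + 1) n b (Fin.last (M + 1)) (decide (M < n)) := rfl
  have φ1 : φ (((braid M n b).addMark x).oldPoint y ((braid M n b).newPoint x)) =
      braidPt (M + 1) n b (Fin.last (M + 1)) (!decide (M < n)) := rfl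
  have φ2 : ∀ j β, φ (((braid M n b).addMark x).oldPoint y ((braid M n b).oldPoint x
      (braidPt M n b j β))) = braidPt (M + 1) n b j.castSucc β := fun _ _ => rfl
  have hlast : decide ((Fin.last (M + 1)).val < n) = false :=
    decide_eq_false (by rw [Fin.val_last]; omega)
  refine ⟨⟨φ, ⟨fun c => ⟨c.1.castSucc, c.2⟩, fun c => ⟨⟨c.1.val, lt_of_lt_of_le c.2 hn⟩, c.2⟩,
    fun c => rfl, fun c => rfl⟩, ?_, fun c => rfl, fun c => rfl, fun c => rfl⟩⟩
  intro z
  rcases addMark_cases _ y z with rfl | ⟨w, rfl⟩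
  · rw [addMark_next_new, hy, addMark_next_of_ne _ _ (fun h => hxy (by rw [hy, h])), braid_next,
      φ2, φ0, braid_next, hlast]
    simp
  · rcases addMark_cases _ x w with rfl | ⟨w, rfl⟩
    · rw [addMark_next_of_ne _ _ hny, addMark_next_new, hx, braid_next, ← hx, φ2, φ1,
        braid_next, hlast]
      simp
    · obtain ⟨j, β⟩ := w
      change φ ((((braid M n b).addMark x).addMark y).next (((braid M n b).addMark x).oldPoint y
        ((braid M n b).oldPoint x (braidPt M n b j β)))) = (braid (M + 1) n b).next
          (φ (((braid M n b).addMark x).oldPoint y ((braid M n b).oldPoint x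
            (braidPt M n b j β))))
      rw [φ2, braid_next]
      by_cases hj : j = Fin.last M
      · subst hj
        cases β
        · rw [← hy, addMark_next_self, φ0]
          simp
        · rw [← hx, addMark_next_of_ne _ _ hxy.symm, addMark_next_self, φ1]
          simp
      · have h1 : braidPt M n b j β ≠ x := fun h => hj (braidPt_injective M n b h).1
        have h2 : (braid M n b).oldPoint x (braidPt M n b j β) ≠ y := fun h =>
          hj (braidPt_injective M n b ((braid M n b).oldPoint_injective x h)).1
        rw [addMark_next_of_ne _ _ h2, addMark_next_of_ne _ _ h1, braid_next, φ2]
        congr 1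
        ext
        have h3 : j.val < M := lt_of_le_of_ne (Nat.lt_succ_iff.1 j.isLt) fun h => hj (Fin.ext h)
        rw [Fin.val_castSucc, Fin.val_add_one_of_lt (Fin.lt_last_iff_ne_last.2 hj),
          Fin.val_add_one_of_lt (Fin.castSucc_lt_last j), Fin.val_castSucc]

theorem planar_braid_succ_iff {M n : ℕ} (b : Bool) (hn : n ≤ M + 1) :
    (braid (M + 1) n b).Planar ↔ (braid M n b).Planar := by
  obtain ⟨x, y, ⟨e⟩⟩ := exists_iso_braid_succ b hn
  rw [← e.toShapeIso.planar_iff, planar_addMark_iff, planar_addMark_iff]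

/-- Levels of marks can be dropped, which leaves two circles or a braid all of whose levels are
crossings. -/
theorem planar_braid {M n : ℕ} (b : Bool) (hn : n ≤ M + 1) : (braid M n b).Planar := by
  cases n with
  | zero =>
    clear hn
    induction M with
    | zero => exact (braidZeroIso b).toShapeIso.planar_iff.1 (planar_circles 2)
    | succ M ih => exact (planar_braid_succ_iff b (Nat.zero_le _)).2 ih
  | succ n =>
    obtain ⟨k, rfl⟩ := Nat.exists_eq_add_of_le (Nat.succ_le_succ_iff.1 hn)
    clear hn
    induction k with
    | zero => exact planar_braid_full n b
    | succ k ih => exact (planar_braid_succ_iff b (Nat.succ_le_succ (Nat.le_add_right n k))).2 ih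

theorem Equivalent.of_move (hD : D.Planar) (hE : E.Planar) (h : Move D E) : Equivalent D E :=
  Relation.EqvGen.rel _ _ ⟨hD, hE, h⟩

theorem Equivalent.of_iso (hD : D.Planar) (e : Iso D E) : Equivalent D E :=
  .of_move hD (e.toShapeIso.planar_iff.1 hD) (.iso e)

theorem Equivalent.addMark (hD : D.Planar) (x : D.X) : Equivalent D (D.addMark x) :=
  .of_move hD ((planar_addMark_iff D x).2 hD) (.mark D x)

theorem Equivalent.symm (h : Equivalent D E) : Equivalent E D := Relation.EqvGen.symm _ _ h

theorem Equivalent.trans (h : Equivalent D E) (h' : Equivalent E F) : Equivalent D F :=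
  Relation.EqvGen.trans _ _ _ h h'

theorem equivalent_braid_succ {M n : ℕ} (b : Bool) (hn : n ≤ M + 1) :
    Equivalent (braid M n b) (braid (M + 1) n b) := by
  obtain ⟨x, y, ⟨e⟩⟩ := exists_iso_braid_succ b hn
  have h0 := planar_braid b hn
  have h1 := (planar_addMark_iff _ x).2 h0
  exact (Equivalent.addMark h0 x).trans ((Equivalent.addMark h1 y).trans
    (.of_iso ((planar_addMark_iff _ y).2 h1) e))

theorem equivalent_braid_add {M n : ℕ} (b : Bool) (hn : n ≤ M + 1) (k : ℕ) :
    Equivalent (braid M n b) (braid (M + k) n b) := by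
  induction k with
  | zero => exact Relation.EqvGen.refl _
  | succ k ih => exact ih.trans (equivalent_braid_succ b (by omega))

/-- The crossing on a given level. -/
def braidCrossing {M n : ℕ} (b : Bool) (j : Fin (M + 1)) (hj : j.val < n) :
    (braid M n b).C := ⟨j, hj⟩

/-- Smoothing the last crossing of a braid. -/
noncomputable def smoothBraidIso {M n : ℕ} (b : Bool) (hn : n < M + 1) :
    Iso ((braid M (n + 1) b).smooth (braidCrossing b ⟨n, hn⟩ (Nat.lt_succ_self n)))
      (braid M n b) where
  onX := Equiv.refl _
  onC := ⟨fun c => ⟨c.1.1, lt_of_le_of_ne (Nat.lt_succ_iff.1 c.1.2) fun h =>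
      c.2 (Subtype.ext (Fin.ext h))⟩,
    fun c => ⟨⟨c.1, Nat.lt_succ_of_lt c.2⟩, fun h => c.2.ne (congrArg (fun z => z.1.val) h)⟩,
    fun _ => rfl, fun _ => rfl⟩
  next_comm := by
    rintro ⟨j, β⟩
    classical
    rw [smooth_next]
    change (braid M (n + 1) b).next (Equiv.swap (braidPt M (n + 1) b ⟨n, hn⟩ true)
      (braidPt M (n + 1) b ⟨n, hn⟩ false) (braidPt M (n + 1) b j β)) =
        (braid M n b).next (braidPt M n b j β)
    rw [braid_next]
    by_cases hj : j = ⟨n, hn⟩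
    · subst hj
      -- The transposition of the smoothing cancels the exchange of strands at the crossing, so
      -- level `n` becomes a level of marks.
      have h : Equiv.swap (braidPt M (n + 1) b ⟨n, hn⟩ true) (braidPt M (n + 1) b ⟨n, hn⟩ false)
          (braidPt M (n + 1) b ⟨n, hn⟩ β) = braidPt M (n + 1) b ⟨n, hn⟩ (!β) := by
        cases β
        · exact Equiv.swap_apply_right _ _
        · exact Equiv.swap_apply_left _ _
      rw [h, braid_next]
      simp
      rfl
    · rw [Equiv.swap_apply_of_ne_of_ne (fun h => hj (braidPt_injective _ _ _ h).1)
        (fun h => hj (braidPt_injective _ _ _ h).1), braid_next]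
      have : j.val ≠ n := fun h => hj (Fin.ext h)
      have h2 : (j.val < n + 1) ↔ (j.val < n) := by omega
      simp only [h2]
      rfl
  left_comm _ := rfl
  right_comm _ := rfl
  positive_comm _ := rfl

/-- Exchanging the strands on one level. -/
def flipLevel (M k : ℕ) : Equiv.Perm (Fin (M + 1) × Bool) :=
  Function.Involutive.toPerm (fun x => (x.1, xor x.2 (decide (x.1.val = k)))) (fun x => by simp)

/-- Two last crossings of opposite signs cancel in a braid. -/
noncomputable def eraseBraidIso {M n : ℕ} (b : Bool) (hn : n + 1 < M + 1) :
    Iso (((braid M (n + 2) b).withSign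
        (braidCrossing b ⟨n + 1, hn⟩ (Nat.lt_succ_self _)) (!b)).erase
      {braidCrossing b ⟨n, Nat.lt_of_succ_lt hn⟩ (by simp),
        braidCrossing b ⟨n + 1, hn⟩ (Nat.lt_succ_self _)}) (braid M n b) where
  -- After the erasure the strands still change places at the levels `n` and `n + 1`. Exchanging the
  -- labels on level `n + 1` straightens both.
  onX := flipLevel M (n + 1)
  onC := ⟨fun c => ⟨c.1.1, by
      have h1 := c.1.2
      have h2 : c.1.1.val ≠ n := fun h => c.2 (Or.inl (Subtype.ext (Fin.ext h)))
      have h3 : c.1.1.val ≠ n + 1 := fun h => c.2 (Or.inr (Subtype.ext (Fin.ext h)))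
      omega⟩,
    fun c => ⟨⟨c.1, Nat.lt_succ_of_lt (Nat.lt_succ_of_lt c.2)⟩, by
      rintro (h | h)
      · exact c.2.ne (congrArg (fun z => z.1.val) h)
      · exact (Nat.lt_succ_of_lt c.2).ne (congrArg (fun z => z.1.val) h)⟩,
    fun _ => rfl, fun _ => rfl⟩
  next_comm := by
    rintro ⟨j, β⟩
    change flipLevel M (n + 1) ((braid M (n + 2) b).next (braidPt M (n + 2) b j β)) =
      (braid M n b).next (braidPt M n b j (xor β (decide (j.val = n + 1))))
    rw [braid_next, braid_next]
    change braidPt M n b (j + 1) (xor (xor β (decide (j.val < n + 2)))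
      (decide ((j + 1).val = n + 1))) = _
    congr 1
    -- The wrap-around does no harm: the last level is followed by 0, which is not `n + 1`, and `n <
    -- M` by `hn`.
    have h1 : (j + 1).val = n + 1 ↔ j.val = n := by
      by_cases hj : j = Fin.last M
      · subst hj
        simp
        omega
      · rw [Fin.val_add_one_of_lt (Fin.lt_last_iff_ne_last.2 hj)]
        omega
    simp only [h1]
    rcases lt_trichotomy j.val n with h | h | h
    · rw [decide_eq_true (by omega : j.val < n + 2), decide_eq_false (by omega : ¬ j.val = n),
        decide_eq_false (by omega : ¬ j.val = n + 1), decide_eq_true h]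
      simp
    · rw [decide_eq_true (by omega : j.val < n + 2), decide_eq_true h,
        decide_eq_false (by omega : ¬ j.val = n + 1), decide_eq_false (by omega : ¬ j.val < n)]
      simp
    · rw [decide_eq_false (by omega : ¬ j.val = n), decide_eq_false (by omega : ¬ j.val < n)]
      by_cases h2 : j.val = n + 1
      · rw [decide_eq_true (by omega : j.val < n + 2), decide_eq_true h2]
      · rw [decide_eq_false (by omega : ¬ j.val < n + 2), decide_eq_false h2]
  left_comm c := by
    have h3 : c.1.1.val ≠ n + 1 := fun h => c.2 (Or.inr (Subtype.ext (Fin.ext h)))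
    change (c.1.1, xor true (decide (c.1.1.val = n + 1))) = (c.1.1, true)
    simp [h3]
  right_comm c := by
    have h3 : c.1.1.val ≠ n + 1 := fun h => c.2 (Or.inr (Subtype.ext (Fin.ext h)))
    change (c.1.1, xor false (decide (c.1.1.val = n + 1))) = (c.1.1, false)
    simp [h3]
  positive_comm c := by
    exact positive_withSign_of_ne (D := braid M (n + 2) b) _ _ fun h => c.2 (Or.inr h)

end LinkDiagram

namespace LinkDiagram

variable {D E F : LinkDiagram}

/-! ### The Conway polynomial of torus links -/

theorem points_of_positive {c : D.C} (h : D.positive c = true) :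
    D.overPt c = D.left c ∧ D.underPt c = D.right c := by
  unfold overPt underPt
  simp [h]

theorem points_of_negative {c : D.C} (h : D.positive c = false) :
    D.overPt c = D.right c ∧ D.underPt c = D.left c := by
  unfold overPt underPt
  simp [h]

/-- Undoing a bigon between the last two levels of a braid. -/
theorem equivalent_withSign_braid {M n : ℕ} (b : Bool) (hn : n + 1 < M + 1) :
    Equivalent ((braid M (n + 2) b).withSign
      (braidCrossing b ⟨n + 1, hn⟩ (Nat.lt_succ_self _)) (!b)) (braid M n b) := by
  set c₀ : (braid M (n + 2) b).C := braidCrossing b ⟨n, Nat.lt_of_succ_lt hn⟩ (by simp) with hc₀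
  set c₁ : (braid M (n + 2) b).C := braidCrossing b ⟨n + 1, hn⟩ (Nat.lt_succ_self _) with hc₁
  have hne : c₀ ≠ c₁ := fun h => by
    have := congrArg (fun z => z.1.val) h
    simp [hc₀, hc₁, braidCrossing] at this
  set T := (braid M (n + 2) b).withSign c₁ (!b) with hT
  have hp : T.Planar := (planar_braid b (by omega)).withSign c₁ (!b)
  have e : Iso (T.erase {c₀, c₁}) (braid M n b) := eraseBraidIso b hn
  have hpe : (T.erase {c₀, c₁}).Planar := e.toShapeIso.planar_iff.2 (planar_braid b (by omega))
  refine Equivalent.trans (.of_move hp hpe ?_) (.of_iso hpe e)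
  have hnext : ∀ β, (braid M (n + 2) b).next (braidPt M (n + 2) b ⟨n, Nat.lt_of_succ_lt hn⟩ β) =
      braidPt M (n + 2) b ⟨n + 1, hn⟩ (!β) := by
    intro β
    rw [braid_next, decide_eq_true (by simp), Bool.xor_true]
    congr 1
    ext
    rw [Fin.val_add_one_of_lt]
    rw [Fin.lt_def, Fin.val_last]
    change n < M
    omega
  have hsymm : ∀ β, (braid M (n + 2) b).next.symm (braidPt M (n + 2) b ⟨n + 1, hn⟩ β) =
      braidPt M (n + 2) b ⟨n, Nat.lt_of_succ_lt hn⟩ (!β) := by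
    intro β
    rw [Equiv.symm_apply_eq, hnext, Bool.not_not]
  have k0 : T.Corner c₀ (braidPt M (n + 2) b ⟨n, Nat.lt_of_succ_lt hn⟩ true, .L)
      (braidPt M (n + 2) b ⟨n, Nat.lt_of_succ_lt hn⟩ false, .R) := Or.inl (CornerAux.top (D := T))
  have k1 : T.Corner c₁ (braidPt M (n + 2) b ⟨n, Nat.lt_of_succ_lt hn⟩ true, .L)
      (braidPt M (n + 2) b ⟨n, Nat.lt_of_succ_lt hn⟩ false, .R) := by
    refine Or.inr ?_
    have := CornerAux.bottom (D := T) (c := c₁)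
    have h1 : T.next.symm (T.left c₁) = braidPt M (n + 2) b ⟨n, Nat.lt_of_succ_lt hn⟩ false :=
      hsymm true
    have h2 : T.next.symm (T.right c₁) = braidPt M (n + 2) b ⟨n, Nat.lt_of_succ_lt hn⟩ true :=
      hsymm false
    rwa [h1, h2] at this
  have hs0 : T.positive c₀ = b := positive_withSign_of_ne _ _ hne
  have hs1 : T.positive c₁ = !b := positive_withSign_self _ _
  have hl0 : T.left c₀ = braidPt M (n + 2) b ⟨n, Nat.lt_of_succ_lt hn⟩ true := rfl
  have hr0 : T.right c₀ = braidPt M (n + 2) b ⟨n, Nat.lt_of_succ_lt hn⟩ false := rfl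
  have hl1 : T.left c₁ = T.next (braidPt M (n + 2) b ⟨n, Nat.lt_of_succ_lt hn⟩ false) :=
    (hnext false).symm
  have hr1 : T.right c₁ = T.next (braidPt M (n + 2) b ⟨n, Nat.lt_of_succ_lt hn⟩ true) :=
    (hnext true).symm
  -- The strand leaving the left point of `c₀` is over at both crossings if `b` is true and under at
  -- both if `b` is false. So the two edges of the bigon exchange roles.
  cases b
  · refine Move.r2 T c₀ c₁ _ _ hne k0.symm k1.symm ⟨⟨c₀, ?_⟩, ⟨c₁, ?_⟩⟩ ⟨⟨c₀, ?_⟩, ⟨c₁, ?_⟩⟩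
    · exact (points_of_negative hs0).1.trans hr0
    · exact (points_of_positive hs1).1.trans hl1
    · exact (points_of_negative hs0).2.trans hl0
    · exact (points_of_positive hs1).2.trans hr1
  · refine Move.r2 T c₀ c₁ _ _ hne k0 k1 ⟨⟨c₀, ?_⟩, ⟨c₁, ?_⟩⟩ ⟨⟨c₀, ?_⟩, ⟨c₁, ?_⟩⟩
    · exact (points_of_positive hs0).1.trans hl0
    · exact (points_of_negative hs1).1.trans hr1
    · exact (points_of_positive hs0).2.trans hr0
    · exact (points_of_negative hs1).2.trans hl1

/-- The point of a circle without crossings. -/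
def circlePt : (circles 1).X := (0 : Fin 1)

/-- The circle with a kink becomes a circle with one mark when the kink is removed. -/
noncomputable def eraseKinkIso (b : Bool) :
    Iso ((circles 1).addMark circlePt)
      ((braid 0 1 b).erase {braidCrossing b 0 Nat.zero_lt_one}) where
  onX := ⟨fun z => match z with
      | none => ((0 : Fin 1), false)
      | some _ => ((0 : Fin 1), true),
    fun z => match z with
      | (_, false) => none
      | (_, true) => some (0 : Fin 1), by
        rintro (_ | z)
        · rfl
        · exact congrArg some (Subsingleton.elim (α := Fin 1) _ _), by
        rintro ⟨z, (_ | _)⟩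
        · exact Prod.ext (Subsingleton.elim (α := Fin 1) _ _) rfl
        · exact Prod.ext (Subsingleton.elim (α := Fin 1) _ _) rfl⟩
  onC := ⟨Empty.elim, fun c => absurd (Subtype.ext (Subsingleton.elim (α := Fin 1) _ _)) c.2,
    fun c => c.elim, fun c => absurd (Subtype.ext (Subsingleton.elim (α := Fin 1) _ _)) c.2⟩
  next_comm z := by
    have h := braid_next 0 1 b 0
    rcases addMark_cases (circles 1) circlePt z with rfl | ⟨w, rfl⟩
    · exact (congrArg _ (addMark_next_new (circles 1) circlePt)).trans (h false).symm
    · obtain rfl : w = circlePt := Subsingleton.elim (α := Fin 1) _ _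
      exact (congrArg _ (addMark_next_self (circles 1) circlePt)).trans (h true).symm
  left_comm c := c.elim
  right_comm c := c.elim
  positive_comm c := c.elim

theorem equivalent_circles_braid (b : Bool) : Equivalent (circles 1) (braid 0 1 b) := by
  have h0 := planar_circles 1
  have h1 := (planar_addMark_iff (circles 1) circlePt).2 h0
  have h2 := (eraseKinkIso b).toShapeIso.planar_iff.1 h1
  refine (Equivalent.addMark h0 _).trans ((Equivalent.of_iso h1 (eraseKinkIso b)).trans
    (Equivalent.symm (.of_move (planar_braid b le_rfl) h2 ?_)))
  -- The east corner of the only crossing joins the right side of this edge to itself, so the face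
  -- has one side.
  refine Move.r1 _ _ (braidPt 0 1 b 0 true, .R) (Or.inl ?_)
  have h3 := CornerAux.east (D := braid 0 1 b) (c := braidCrossing b 0 Nat.zero_lt_one)
  have h4 : (braid 0 1 b).next.symm ((braid 0 1 b).right (braidCrossing b 0 Nat.zero_lt_one)) =
      braidPt 0 1 b 0 true := braid_next_symm 0 1 b 0 false
  rwa [h4] at h3

/-- The Conway polynomials of the closures of braids with two strands. -/
noncomputable def torusConway (b : Bool) : ℕ → ℤ[X]
  | 0 => 0
  | 1 => 1
  | n + 2 => if b then torusConway b n + Polynomial.X * torusConway b (n + 1)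
      else torusConway b n - Polynomial.X * torusConway b (n + 1)

theorem withSign_braid {M n : ℕ} (b : Bool) (c : (braid M n b).C) :
    (braid M n b).withSign c b = braid M n b := by
  classical
  refine congrArg (fun f => ({ braid M n b with positive := f } : LinkDiagram)) ?_
  exact Function.update_eq_self c (braid M n b).positive

/-- The skein relation is applied at the last crossing: changing it creates a bigon with the
crossing before, which leaves `n` crossings, and smoothing it leaves `n + 1`. -/
theorem hasConway_braid (b : Bool) (n : ℕ) :
    ∀ M, n ≤ M + 1 → HasConway (braid M n b) (torusConway b n) := by
  induction n using Nat.twoStepInduction with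
  | zero =>
    intro M _
    have h := equivalent_braid_add b (Nat.zero_le (0 + 1)) M
    rw [Nat.zero_add] at h
    exact .invariant h (.invariant (.of_iso (planar_circles 2) (braidZeroIso b))
      (.unlink 2 le_rfl))
  | one =>
    intro M _
    have h := equivalent_braid_add b (le_refl (0 + 1)) M
    rw [Nat.zero_add M] at h
    exact .invariant h (.invariant (equivalent_circles_braid b) .unknot)
  | more n ih₀ ih₁ =>
    intro M hM
    have hn : n + 1 < M + 1 := by omega
    let c : (braid M (n + 2) b).C := braidCrossing b ⟨n + 1, hn⟩ (Nat.lt_succ_self _)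
    have hp : (braid M (n + 2) b).Planar := planar_braid b hM
    have h₁ : HasConway ((braid M (n + 2) b).withSign c (!b)) (torusConway b n) :=
      .invariant (equivalent_withSign_braid b hn).symm (ih₀ M (by omega))
    have e : Iso ((braid M (n + 2) b).smooth c) (braid M (n + 1) b) := smoothBraidIso b hn
    have h₀ : HasConway ((braid M (n + 2) b).smooth c) (torusConway b (n + 1)) :=
      .invariant (Equivalent.of_iso (e.toShapeIso.planar_iff.2 (planar_braid b (by omega))) e).symm
        (ih₁ M (by omega))
    rw [← withSign_braid b c, torusConway]
    cases b
    · exact .skein_neg _ c hp h₁ h₀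
    · exact .skein_pos _ c hp h₁ h₀

/-- The even closures have linking number ±k, and these numbers add up to the z² coefficients of the
odd ones. The sign of the crossings enters twice there and cancels; the factor 2 avoids a division.
-/
theorem torusConway_coeff (b : Bool) (k : ℕ) :
    (torusConway b (2 * k)).coeff 0 = 0 ∧ (torusConway b (2 * k + 1)).coeff 0 = 1 ∧
    (torusConway b (2 * k)).coeff 1 = (if b then (k : ℤ) else -k) ∧
    2 * (torusConway b (2 * k + 1)).coeff 2 = k * (k + 1) := by
  induction k with
  | zero => simp [torusConway, coeff_one]
  | succ k ih =>
    obtain ⟨h1, h2, h3, h4⟩ := ih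
    have e1 : torusConway b (2 * (k + 1)) = if b then
        torusConway b (2 * k) + Polynomial.X * torusConway b (2 * k + 1)
        else torusConway b (2 * k) - Polynomial.X * torusConway b (2 * k + 1) := by
      rw [show 2 * (k + 1) = 2 * k + 2 by ring, torusConway]
    have e2 : torusConway b (2 * (k + 1) + 1) = if b then
        torusConway b (2 * k + 1) + Polynomial.X * torusConway b (2 * (k + 1))
        else torusConway b (2 * k + 1) - Polynomial.X * torusConway b (2 * (k + 1)) := by
      rw [show 2 * (k + 1) + 1 = (2 * k + 1) + 2 by ring, torusConway,
        show 2 * k + 1 + 1 = 2 * (k + 1) by ring]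
    have s0 : ∀ p : ℤ[X], (Polynomial.X * p).coeff 0 = 0 := fun p => by simp
    have s1 : ∀ p : ℤ[X], (Polynomial.X * p).coeff 1 = p.coeff 0 := fun p => coeff_X_mul p 0
    have s2 : ∀ p : ℤ[X], (Polynomial.X * p).coeff 2 = p.coeff 1 := fun p => coeff_X_mul p 1
    cases b
    · simp only [Bool.false_eq_true, if_false] at h3 e1 e2 ⊢
      have e3 : (torusConway false (2 * (k + 1))).coeff 1 = -((k + 1 : ℕ) : ℤ) := by
        rw [e1, coeff_sub, s1, h2, h3]
        push_cast
        ring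
      refine ⟨by rw [e1, coeff_sub, s0, h1, sub_zero], by rw [e2, coeff_sub, s0, h2, sub_zero],
        e3, ?_⟩
      rw [e2, coeff_sub, s2, e3, mul_sub, h4]
      push_cast
      ring
    · simp only [if_true] at h3 e1 e2 ⊢
      have e3 : (torusConway true (2 * (k + 1))).coeff 1 = ((k + 1 : ℕ) : ℤ) := by
        rw [e1, coeff_add, s1, h2, h3]
        push_cast
        ring
      refine ⟨by rw [e1, coeff_add, s0, h1, add_zero], by rw [e2, coeff_add, s0, h2, add_zero],
        e3, ?_⟩
      rw [e2, coeff_add, s2, e3, mul_add, h4]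
      push_cast
      ring

/-- The standard diagram of a torus link is the closure of a braid. -/
theorem exists_iso_torusTwo (M : ℕ) (b : Bool) : Nonempty
    (Iso (torusTwo (if b then ((M + 1 : ℕ) : ℤ) else Int.negSucc M)) (braid M (M + 1) b)) := by
  cases b
  · refine ⟨⟨Equiv.refl (Fin (M + 1) × Bool), (Equiv.subtypeUnivEquiv fun j => j.isLt).symm, ?_,
      fun _ => rfl, fun _ => rfl, fun _ => ?_⟩⟩
    · rintro ⟨j, β⟩
      refine Eq.trans ?_ (braid_next M (M + 1) false j β).symm
      refine Prod.ext ?_ ?_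
      · exact finRotate_apply j
      · change (!β) = xor β (decide (j.val < M + 1))
        rw [decide_eq_true (p := j.val < M + 1) j.isLt, Bool.xor_true]
    · exact decide_eq_false (Int.negSucc_lt_zero M).le.not_gt
  · refine ⟨⟨Equiv.refl (Fin (M + 1) × Bool), (Equiv.subtypeUnivEquiv fun j => j.isLt).symm, ?_,
      fun _ => rfl, fun _ => rfl, fun _ => ?_⟩⟩
    · rintro ⟨j, β⟩
      refine Eq.trans ?_ (braid_next M (M + 1) true j β).symm
      refine Prod.ext ?_ ?_
      · exact finRotate_apply j
      · change (!β) = xor β (decide (j.val < M + 1))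
        rw [decide_eq_true (p := j.val < M + 1) j.isLt, Bool.xor_true]
    · exact decide_eq_true (by simp)

theorem hasConway_torusTwo (M : ℕ) (b : Bool) :
    HasConway (torusTwo (if b then ((M + 1 : ℕ) : ℤ) else Int.negSucc M))
      (torusConway b (M + 1)) := by
  obtain ⟨e⟩ := exists_iso_torusTwo M b
  exact .invariant (Equivalent.of_iso (e.toShapeIso.planar_iff.2 (planar_braid b le_rfl)) e).symm
    (hasConway_braid b (M + 1) M le_rfl)

/-- The Conway polynomial of a `(2, q)`-torus knot exists, and its low coefficients are known. -/
theorem exists_hasConway_torusTwo {q : ℤ} (hq : q ≡ 1 [ZMOD 2]) :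
    ∃ p, HasConway (torusTwo q) p ∧ p.coeff 0 = 1 ∧
      (p.coeff 2 : ℚ) = ((q : ℚ) - 1) * ((q : ℚ) + 1) / 8 := by
  have hq' : q % 2 = 1 := hq
  have key : ∀ (b : Bool) (k : ℕ), q = (if b then ((2 * k + 1 : ℕ) : ℤ) else Int.negSucc (2 * k)) →
      ∃ p, HasConway (torusTwo q) p ∧ p.coeff 0 = 1 ∧
      (p.coeff 2 : ℚ) = ((q : ℚ) - 1) * ((q : ℚ) + 1) / 8 := by
    intro b k hk
    obtain ⟨-, h2, -, h4⟩ := torusConway_coeff b k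
    refine ⟨torusConway b (2 * k + 1), hk ▸ hasConway_torusTwo (2 * k) b, h2, ?_⟩
    have h5 : 2 * ((torusConway b (2 * k + 1)).coeff 2 : ℚ) = k * (k + 1) := by exact_mod_cast h4
    -- Only q² matters, and (2k+1)² - 1 = 4k(k+1) for both signs of q.
    have h6 : (q : ℚ) * q = (2 * k + 1) * (2 * k + 1) := by
      rw [hk]
      cases b
      · simp only [Bool.false_eq_true, if_false, Int.negSucc_eq]
        push_cast
        ring
      · simp
    linarith
  rcases q with q | q
  · refine key true (q / 2) ?_
    simp only [Int.ofNat_eq_natCast, if_true] at hq' ⊢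
    omega
  · refine key false (q / 2) ?_
    simp only [Bool.false_eq_true, if_false]
    congr 1
    omega

end LinkDiagram

theorem mainTheorem4 (q : ℤ) (hq : q ≡ 1 [ZMOD 2])
    (D : LinkDiagram) (hD : LinkDiagram.Equivalent (LinkDiagram.torusTwo q) D) :
    (∃ p : Polynomial ℤ, LinkDiagram.HasConway D p) ∧
    ∀ p : Polynomial ℤ, LinkDiagram.HasConway D p →
      (p.coeff 2 : ℚ) = ((q : ℚ) - 1) * ((q : ℚ) + 1) / 8 := by
  obtain ⟨p₀, h, h0, h2⟩ := LinkDiagram.exists_hasConway_torusTwo hq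
  have hp₀ : LinkDiagram.HasConway D p₀ := .invariant hD h
  -- That the link is a knot is read off from the constant term 1 of `p₀`, with no inspection of
  -- cycles.
  have hK : D.IsKnot := by
    by_contra hK
    have := hp₀.lowCoeffs.coeff_zero' hK
    omega
  exact ⟨⟨p₀, hp₀⟩, fun p hp => by rw [hK.coeff_two_eq hp hp₀, h2]⟩
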